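/- Let $d\in\mathbb N$, and let $a:[0,\infty)\to\mathbb R$ be measurable with $0<a_0\le a(t)\le a_1$ for all $t\ge 0$, where $a_0,a_1$ are constants. For $f:\mathbb Z^d\to\mathbb C$ put $D_j^+f[k]=f[k+e_j]-f[k]$ and $D_j^-f[k]=f[k]-f[k-e_j]$, and consider the semi-discrete wave equation $$u''(t)[k]-a(t)^2\sum_{j=1}^d D_j^+D_j^-u(t)[k]=0\quad (t\ge 0,\ k\in\mathbb Z^d),\qquad u(0)=u_0,\quad u'(0)=u_1 .$$ Consider solutions $u$ of finite energy, i.e. $u'(t)\in\ell^2(\mathbb Z^d)$ and $D_j^+u(t)\in \ell^2(\mathbb Z^d)$ for all $t\ge0$ and $j=1,\dots,d$ (where, as $a$ may be discontinuous, each $u'(\cdot)[k]$ is only required to be locally absolutely continuous, with the equation holding for almost every $t$), and let $$E(t)=\sum_{k\in\mathbb Z^d}|u'(t)[k]|^2+a(t)^2\sum_{j=1}^d\sum_{k\in\mathbb Z^d}|D_j^+u(t)[k]|^2 .$$ *Generalized energy conservation* (GEC) means: there is a constant $C>0$, independent of $t$ and of the solution, such that $C^{-1}E(0)\le E(t)\le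 C\,E(0)$ for all $t\ge 0$ and all such solutions $u$. For positive, monotone increasing functions $\Theta,\Xi$ on $[0,\infty)$ and an integer $m\ge 1$ consider the conditions: * (H1\*) there is a constant $a_\infty>0$ with $\int_0^t|a(s)-a_\infty|\,ds\le\Theta(t)$ for all $t\ge 0$; * (H2\*) $a\in C^m([0,\infty))$, and there are constants $C_k>0$ with $|a^{(k)}(t)|\le C_k\,\Xi(t)^{-k}$ for all $t\ge 0$ and $k=1,\dots,m$; * (H3\*) there is a constant $C_0>0$ with $\Theta(t)\le C_0\,\Xi(t)$ for all $t\ge 0$; * (H4\*) $m\ge 2$, $\Xi^{-m}\in L^1([0,\infty))$ and $\sup_{t\ge0}\Theta(t)^{m-1}\int_t^\infty\Xi(s)^{-m}\,ds<\infty$. Then GEC holds if any of the following is satisfied: * (i) (H1\*) holds for some $\Theta$ with $\sup_{t\ge0}\Theta(t)<\infty$; * (ii) (H2\*) holds with $m=1$ for some $\Xi$ with $\Xi^{-1}\in L^1([0,\infty))$; * (iii) (H1\*), (H2\*), (H3\*) and (H4\*) hold for some $\Theta$, $\Xi$ and $m$. -/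

import Mathlib

open Set MeasureTheory
open scoped ENNReal

namespace SemiDiscreteWave

noncomputable section

/-- The forward difference operator `D_j^+` on complex functions on the lattice `ℤ^d`. -/
def forwardDiff {d : ℕ} (j : Fin d) (f : (Fin d → ℤ) → ℂ) : (Fin d → ℤ) → ℂ :=
  fun k => f (k + Pi.single j 1) - f k

/-- The backward difference operator `D_j^-` on complex functions on the lattice `ℤ^d`. -/
def backwardDiff {d : ℕ} (j : Fin d) (f : (Fin d → ℤ) → ℂ) : (Fin d → ℤ) → ℂ :=
  fun k => f k - f (k - Pi.single j 1)

/-- The discrete Laplace operator `∑_j D_j^+ D_j^-`. -/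
def discreteLaplacian {d : ℕ} (f : (Fin d → ℤ) → ℂ) : (Fin d → ℤ) → ℂ :=
  fun k => ∑ j : Fin d, forwardDiff j (backwardDiff j f) k

/-- The time derivative `u'(t)[k]` on `[0, ∞)` (one-sided at `t = 0`). -/
def velocity {d : ℕ} (u : ℝ → (Fin d → ℤ) → ℂ) (t : ℝ) : (Fin d → ℤ) → ℂ :=
  fun k => derivWithin (fun s => u s k) (Ici 0) t

/-- `u` is a finite-energy solution on `[0, ∞)` of the initial value problem
`u''(t)[k] - a(t)² ∑_j D_j^+ D_j^- u(t)[k] = 0`, `u(0) = u₀`, `u'(0) = u₁`.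
As `a` need not be continuous, the equation is understood in the usual sense of Carathéodory:
`u'` exists, is locally absolutely continuous, and the equation holds for almost every `t`.
For continuous `a` this is the same as being a classical (twice continuously differentiable)
solution. -/
structure IsSolution {d : ℕ} (a : ℝ → ℝ) (u₀ u₁ : (Fin d → ℤ) → ℂ)
    (u : ℝ → (Fin d → ℤ) → ℂ) : Prop where
  differentiableOn : ∀ k, DifferentiableOn ℝ (fun t => u t k) (Ici 0)
  absolutelyContinuous : ∀ k, ∀ T : ℝ, 0 ≤ T →
    AbsolutelyContinuousOnInterval (fun t => velocity u t k) 0 T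
  equation : ∀ k, ∀ᵐ t : ℝ, 0 < t →
    HasDerivAt (fun s => velocity u s k) (((a t) ^ 2 : ℝ) * discreteLaplacian (u t) k) t
  initial_position : u 0 = u₀
  initial_velocity : velocity u 0 = u₁
  velocity_mem : ∀ t, 0 ≤ t → Memℓp (velocity u t) 2
  forwardDiff_mem : ∀ t, 0 ≤ t → ∀ j, Memℓp (forwardDiff j (u t)) 2

/-- The total energy `E(t) = ∑_k |u'(t)[k]|² + a(t)² ∑_j ∑_k |D_j^+ u(t)[k]|²`. -/
def energy {d : ℕ} (a : ℝ → ℝ) (u : ℝ → (Fin d → ℤ) → ℂ) (t : ℝ) : ℝ :=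
  (∑' k, ‖velocity u t k‖ ^ 2) + (a t) ^ 2 * ∑ j : Fin d, ∑' k, ‖forwardDiff j (u t) k‖ ^ 2

/-- Generalized energy conservation: `E(t) ≃ E(0)` for all finite-energy solutions in dimension
`d`, with a constant that depends neither on `t` nor on the solution. -/
def GEC (d : ℕ) (a : ℝ → ℝ) : Prop :=
  ∃ C : ℝ, 0 < C ∧ ∀ (u₀ u₁ : (Fin d → ℤ) → ℂ) (u : ℝ → (Fin d → ℤ) → ℂ),
    IsSolution a u₀ u₁ u → ∀ t : ℝ, 0 ≤ t →
      energy a u t ≤ C * energy a u 0 ∧ energy a u 0 ≤ C * energy a u t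

/-- Positive and monotone increasing functions on `[0, ∞)`. -/
def PosMono (f : ℝ → ℝ) : Prop :=
  (∀ t, 0 ≤ t → 0 < f t) ∧ MonotoneOn f (Ici 0)

/-- Stabilization: `∫_0^t |a(s) - a_∞| ds ≤ Θ(t)` for some constant `a_∞ > 0`. -/
def Stabilizes (a Θ : ℝ → ℝ) : Prop :=
  ∃ aInf : ℝ, 0 < aInf ∧ ∀ t, 0 ≤ t → ∫ s in (0 : ℝ)..t, |a s - aInf| ≤ Θ t

/-- `a ∈ C^m([0, ∞))` with `m ≥ 1`, and `|a^{(k)}(t)| ≤ C_k Ξ(t)^{-k}` for `k = 1, …, m`. -/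
def DerivBounds (m : ℕ) (a Ξ : ℝ → ℝ) : Prop :=
  1 ≤ m ∧ ContDiffOn ℝ m a (Ici 0) ∧
    ∀ k : ℕ, 1 ≤ k → k ≤ m → ∃ C : ℝ, 0 < C ∧ ∀ t, 0 ≤ t →
      |iteratedDerivWithin k a (Ici 0) t| ≤ C * ((Ξ t) ^ k)⁻¹

/-- `Θ(t) ≤ C₀ Ξ(t)` for some constant `C₀ > 0`. -/
def Dominated (Θ Ξ : ℝ → ℝ) : Prop :=
  ∃ C₀ : ℝ, 0 < C₀ ∧ ∀ t, 0 ≤ t → Θ t ≤ C₀ * Ξ t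

/-- `m ≥ 2`, `Ξ^{-m} ∈ L¹([0, ∞))`, and
`sup_{t ≥ 0} Θ(t)^{m-1} ∫_t^∞ Ξ(s)^{-m} ds < ∞`. -/
def TailBound (m : ℕ) (Θ Ξ : ℝ → ℝ) : Prop :=
  2 ≤ m ∧ IntegrableOn (fun s => ((Ξ s) ^ m)⁻¹) (Ici 0) ∧
    BddAbove ((fun t => (Θ t) ^ (m - 1) * ∫ s in Ioi t, ((Ξ s) ^ m)⁻¹) '' Ici 0)

end

end SemiDiscreteWave

namespace SemiDiscreteWave

/-! ### Absolutely continuous functions and a Gronwall lemma -/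

/-! On the lattice the forward gradient `D` is a bounded operator on ℓ². With `v = u'` and `w = D u`
the equation becomes the first-order system `v' = -a² D†w`, `w' = D v`, which involves only
quantities of finite energy. Diagonalising `D†D` would decouple it into scalar oscillators `v' = -a²
μ z`, `z' = μ v` with `0 ≤ μ ≤ ‖D‖`, so everything reduces to comparing `v² + z²` at two times with
a constant uniform in `μ` (`ModeBound`).

The mode estimates come from quadratic Lyapunov functionals and Gronwall
(`IsMode.comparable_of_quadratic`). In case (i) the form `V² + a∞² Z²` drifts at a rate of order `μ
|a - a∞|`, and `μ` is bounded. In case (ii) `V² + a² Z²` drifts at a rate of order `|a'|`, which is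
integrable. In case (iii) the form of (i) is used until `μ ∫ |a - a∞|` reaches a fixed level. After
that `μ Ξ` is large, and a form built from a WKB correction `X` of `1/a` is invariant up to a rate
`μ^{-(m-1)} Ξ^{-m}` (`exists_wkb`, `exists_comparable_hyperbolic`). At the switching time `1/μ ≤ Θ`,
so (H4*) bounds the total drift.

The passage from modes to waves avoids the spectral theorem. The velocity is projected onto
finite-dimensional spaces, where singular vectors of `D` give exact modes except for a force caused
by the projection defect. The force disappears in the limit (`IsWeakWave.galerkin_estimate`,
`IsWeakWave.energy_comparable`). The limit needs the energy to be bounded on compact time intervals,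
whereas finiteness is assumed only at each single time. A Baire category argument closes this gap
(`exists_bound_of_comparable`). -/

theorem absolutelyContinuousOnInterval_of_hasDerivWithinAt {f f' : ℝ → ℝ} {s t : ℝ} (hst : s ≤ t)
    (hf : ∀ r ∈ Icc s t, HasDerivWithinAt f (f' r) (Icc s t) r)
    (hf' : ContinuousOn f' (Icc s t)) : AbsolutelyContinuousOnInterval f s t := by
  obtain ⟨C, hC⟩ := isCompact_Icc.exists_bound_of_continuousOn hf'
  apply LipschitzOnWith.absolutelyContinuousOnInterval (K := C.toNNReal)
  rw [uIcc_of_le hst]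
  refine (convex_Icc s t).lipschitzOnWith_of_nnnorm_hasDerivWithin_le hf fun x hx => ?_
  rw [← NNReal.coe_le_coe, coe_nnnorm]
  exact (hC x hx).trans (Real.le_coe_toNNReal C)

theorem absolutelyContinuousOnInterval_lipschitz_comp {X Y : Type*} [PseudoMetricSpace X]
    [PseudoMetricSpace Y] {f : ℝ → X} {φ : X → Y} {K : NNReal} {A : Set X} {s t : ℝ}
    (hf : AbsolutelyContinuousOnInterval f s t) (hφ : LipschitzOnWith K φ A)
    (hA : MapsTo f (uIcc s t) A) : AbsolutelyContinuousOnInterval (fun r => φ (f r)) s t := by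
  rw [absolutelyContinuousOnInterval_iff] at hf ⊢
  intro ε hε
  obtain ⟨δ, hδ, h⟩ := hf (ε / (K + 1)) (by positivity)
  refine ⟨δ, hδ, fun E hE hEδ => ?_⟩
  have h1 := h E hE hEδ
  have hle : ∑ i ∈ Finset.range E.1, dist (φ (f (E.2 i).1)) (φ (f (E.2 i).2)) ≤
      K * ∑ i ∈ Finset.range E.1, dist (f (E.2 i).1) (f (E.2 i).2) := by
    rw [Finset.mul_sum]
    exact Finset.sum_le_sum fun i hi =>
      hφ.dist_le_mul _ (hA (hE.1 i hi).1) _ (hA (hE.1 i hi).2)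
  have h0 : 0 ≤ ∑ i ∈ Finset.range E.1, dist (f (E.2 i).1) (f (E.2 i).2) :=
    Finset.sum_nonneg fun i _ => dist_nonneg
  rw [lt_div_iff₀ (by positivity)] at h1
  nlinarith [K.2]

theorem absolutelyContinuousOnInterval_congr {X : Type*} [PseudoMetricSpace X] {f g : ℝ → X}
    {s t : ℝ} (hf : AbsolutelyContinuousOnInterval f s t) (h : EqOn f g (uIcc s t)) :
    AbsolutelyContinuousOnInterval g s t := by
  rw [absolutelyContinuousOnInterval_iff] at hf ⊢
  intro ε hε
  obtain ⟨δ, hδ, H⟩ := hf ε hε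
  refine ⟨δ, hδ, fun E hE hEδ => ?_⟩
  have h1 := H E hE hEδ
  rwa [Finset.sum_congr rfl fun i hi => by rw [h (hE.1 i hi).1, h (hE.1 i hi).2]] at h1

theorem ae_ne_endpoints (s t : ℝ) : ∀ᵐ r : ℝ, r ≠ s ∧ r ≠ t := by
  have h1 : ∀ᵐ r : ℝ, r ≠ s := by simp [ae_iff, measure_singleton]
  have h2 : ∀ᵐ r : ℝ, r ≠ t := by simp [ae_iff, measure_singleton]
  filter_upwards [h1, h2] with r h1 h2 using ⟨h1, h2⟩

/-- An absolutely continuous function grows at most by the integral of a bound of its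
derivative. -/
theorem sub_le_integral_of_ae_deriv_le {p g : ℝ → ℝ} {s t : ℝ} (hst : s ≤ t)
    (hp : AbsolutelyContinuousOnInterval p s t) (hg : IntervalIntegrable g volume s t)
    (h : ∀ᵐ r : ℝ, r ∈ Ioo s t → ∃ p', HasDerivAt p p' r ∧ p' ≤ g r) :
    p t - p s ≤ ∫ r in s..t, g r := by
  rw [← hp.integral_deriv_eq_sub]
  refine intervalIntegral.integral_mono_ae_restrict hst hp.intervalIntegrable_deriv hg ?_
  rw [Filter.EventuallyLE, ae_restrict_iff' measurableSet_Icc]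
  filter_upwards [h, ae_ne_endpoints s t] with r hr hne hmem
  obtain ⟨p', hp', hle⟩ := hr ⟨lt_of_le_of_ne hmem.1 (Ne.symm hne.1), lt_of_le_of_ne hmem.2 hne.2⟩
  rwa [hp'.deriv]

/-- With `B` the primitive of `b`, the functions `q e^{-B}` and `-q e^{B}` have derivatives at most
`g` and `e^{B(t)} g`. The bound on `|q'|` from both sides is what makes the estimate run forwards
and backwards in time. -/
theorem gronwall_of_absolutelyContinuous {q b g : ℝ → ℝ} {s t : ℝ} (hst : s ≤ t)
    (hq : AbsolutelyContinuousOnInterval q s t)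
    (hb : IntervalIntegrable b volume s t) (hb0 : ∀ r ∈ Icc s t, 0 ≤ b r)
    (hg : IntervalIntegrable g volume s t) (hg0 : ∀ r ∈ Icc s t, 0 ≤ g r)
    (h : ∀ᵐ r : ℝ, r ∈ Ioo s t → ∃ q', HasDerivAt q q' r ∧ |q'| ≤ b r * q r + g r) :
    q t ≤ Real.exp (∫ r in s..t, b r) * (q s + ∫ r in s..t, g r) ∧
    q s ≤ Real.exp (∫ r in s..t, b r) * (q t + ∫ r in s..t, g r) := by
  set B : ℝ → ℝ := fun r => ∫ x in s..r, b x with hB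
  have hBac : AbsolutelyContinuousOnInterval B s t :=
    hb.absolutelyContinuousOnInterval_intervalIntegral left_mem_uIcc
  have hBs : B s = 0 := by simp [hB]
  have hB0 : ∀ r ∈ Icc s t, 0 ≤ B r ∧ B r ≤ B t := by
    intro r hr
    have hi1 : IntervalIntegrable b volume s r := hb.mono_set (by
      rw [uIcc_of_le hr.1, uIcc_of_le hst]; exact Icc_subset_Icc_right hr.2)
    have hi2 : IntervalIntegrable b volume r t := hb.mono_set (by
      rw [uIcc_of_le hr.2, uIcc_of_le hst]; exact Icc_subset_Icc_left hr.1)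
    have h1 : 0 ≤ ∫ x in s..r, b x :=
      intervalIntegral.integral_nonneg hr.1 fun x hx => hb0 x ⟨hx.1, hx.2.trans hr.2⟩
    have h2 : 0 ≤ ∫ x in r..t, b x :=
      intervalIntegral.integral_nonneg hr.2 fun x hx => hb0 x ⟨hr.1.trans hx.1, hx.2⟩
    refine ⟨h1, ?_⟩
    have := intervalIntegral.integral_add_adjacent_intervals hi1 hi2
    simp only [hB]; linarith
  have hBd := hb.ae_hasDerivAt_integral
  -- The exponential is Lipschitz only on bounded sets. Since `b ≥ 0`, the values of `B` stay in
  -- `[0, B t]`.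
  have hExp : ∀ c : ℝ, ∃ K : NNReal, LipschitzOnWith K (fun x => Real.exp (c * x))
      (Icc 0 (B t)) := by
    intro c
    have : ContDiffOn ℝ 1 (fun x => Real.exp (c * x)) (Icc 0 (B t)) := by fun_prop
    exact this.exists_lipschitzOnWith (by decide) (convex_Icc _ _) isCompact_Icc
  have hmaps : MapsTo B (uIcc s t) (Icc 0 (B t)) := by
    rw [uIcc_of_le hst]; exact fun r hr => hB0 r hr
  have hEac : ∀ c : ℝ, AbsolutelyContinuousOnInterval (fun r => Real.exp (c * B r)) s t := by
    intro c
    obtain ⟨K, hK⟩ := hExp c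
    exact absolutelyContinuousOnInterval_lipschitz_comp (φ := fun x => Real.exp (c * x)) hBac hK hmaps
  have key : ∀ᵐ r : ℝ, r ∈ Ioo s t → ∃ q', HasDerivAt q q' r ∧ |q'| ≤ b r * q r + g r ∧
      HasDerivAt B (b r) r := by
    filter_upwards [h, hBd] with r h1 h2 hr
    obtain ⟨q', hq', hle⟩ := h1 hr
    refine ⟨q', hq', hle, h2 ?_ s left_mem_uIcc⟩
    rw [uIcc_of_le hst]; exact Ioo_subset_Icc_self hr
  constructor
  · have hp := hq.fun_mul (hEac (-1))
    have := sub_le_integral_of_ae_deriv_le hst hp hg (by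
      filter_upwards [key] with r hk hr
      obtain ⟨q', hq', hle, hB'⟩ := hk hr
      refine ⟨_, hq'.mul ((hB'.const_mul (-1)).exp), ?_⟩
      have hr' := Ioo_subset_Icc_self hr
      have h1 : Real.exp (-1 * B r) ≤ 1 := Real.exp_le_one_iff.2 (by linarith [(hB0 r hr').1])
      have h2 := (Real.exp_pos (-1 * B r)).le
      have h3 := hg0 r hr'
      have h4 := (abs_le.1 hle).2
      nlinarith [mul_le_mul_of_nonneg_left h1 h3, mul_le_mul_of_nonneg_left h4 h2])
    simp only [hBs, mul_zero, Real.exp_zero, mul_one] at this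
    have hE : Real.exp (B t) * Real.exp (-1 * B t) = 1 := by
      rw [← Real.exp_add]; simp
    have hEp := Real.exp_pos (B t)
    calc q t = Real.exp (B t) * (q t * Real.exp (-1 * B t)) := by
          linear_combination -(q t) * hE
      _ ≤ Real.exp (B t) * (q s + ∫ r in s..t, g r) := by gcongr; linarith
  · have hp := (hq.fun_mul (hEac 1)).fun_neg
    have hgE : ∀ r ∈ Icc s t, g r ≤ Real.exp (B t) * g r := fun r hr =>
      le_mul_of_one_le_left (hg0 r hr) (Real.one_le_exp (hB0 t ⟨hst, le_rfl⟩).1)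
    have := sub_le_integral_of_ae_deriv_le hst hp (hg.const_mul (Real.exp (B t))) (by
      filter_upwards [key] with r hk hr
      obtain ⟨q', hq', hle, hB'⟩ := hk hr
      refine ⟨_, (hq'.mul ((hB'.const_mul 1).exp)).neg, ?_⟩
      have hr' := Ioo_subset_Icc_self hr
      have h1 : Real.exp (1 * B r) ≤ Real.exp (B t) := Real.exp_le_exp.2 (by
        linarith [(hB0 r hr').2])
      have h2 := (Real.exp_pos (1 * B r)).le
      have h3 := hg0 r hr'
      have h4 := (abs_le.1 hle).1
      nlinarith [mul_le_mul_of_nonneg_right h1 h3, mul_le_mul_of_nonneg_left h4 h2])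
    rw [intervalIntegral.integral_const_mul] at this
    simp only [hBs, mul_zero, Real.exp_zero, mul_one, one_mul] at this
    change q s ≤ Real.exp (B t) * _
    linarith

/-! ### Scalar modes -/

/-- `v, z` solve `v' = -a² μ z`, `z' = μ v + g` on `[0, T]` in the sense of Carathéodory. -/
structure IsMode (a : ℝ → ℝ) (μ T : ℝ) (g v z : ℝ → ℝ) : Prop where
  ac_v : AbsolutelyContinuousOnInterval v 0 T
  ac_z : AbsolutelyContinuousOnInterval z 0 T
  deriv_v : ∀ᵐ r : ℝ, r ∈ Ioo 0 T → HasDerivAt v (-(a r ^ 2 * μ * z r)) r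
  deriv_z : ∀ᵐ r : ℝ, r ∈ Ioo 0 T → HasDerivAt z (μ * v r + g r) r
  cont_g : ContinuousOn g (Icc 0 T)

/-- The work done by the force `g` in terms of the mode energy. -/
noncomputable def modeWork (g v z : ℝ → ℝ) (s t : ℝ) : ℝ := ∫ r in s..t, √(v r ^ 2 + z r ^ 2) * |g r|

/-- The mode energies at the times `s` and `t` are comparable up to the work of the force. -/
def ModeComparable (K : ℝ) (g v z : ℝ → ℝ) (s t : ℝ) : Prop :=
  v t ^ 2 + z t ^ 2 ≤ K * (v s ^ 2 + z s ^ 2 + modeWork g v z s t) ∧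
  v s ^ 2 + z s ^ 2 ≤ K * (v t ^ 2 + z t ^ 2 + modeWork g v z s t)

section Mode

variable {a : ℝ → ℝ} {μ T : ℝ} {g v z : ℝ → ℝ}

theorem IsMode.continuousOn_work (h : IsMode a μ T g v z) (hT : 0 ≤ T) :
    ContinuousOn (fun r => √(v r ^ 2 + z r ^ 2) * |g r|) (Icc 0 T) := by
  have h1 := h.ac_v.continuousOn
  have h2 := h.ac_z.continuousOn
  rw [uIcc_of_le hT] at h1 h2
  exact (((h1.pow 2).add (h2.pow 2)).sqrt).mul h.cont_g.abs

theorem IsMode.intervalIntegrable_work (h : IsMode a μ T g v z) {s t : ℝ} (hs : 0 ≤ s)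
    (hst : s ≤ t) (ht : t ≤ T) :
    IntervalIntegrable (fun r => √(v r ^ 2 + z r ^ 2) * |g r|) volume s t := by
  apply ContinuousOn.intervalIntegrable
  rw [uIcc_of_le hst]
  exact (h.continuousOn_work (hs.trans (hst.trans ht))).mono (Icc_subset_Icc hs ht)

theorem modeWork_nonneg {s t : ℝ} (hst : s ≤ t) : 0 ≤ modeWork g v z s t :=
  intervalIntegral.integral_nonneg hst fun r _ => by positivity

/-- Comparability from a quadratic Lyapunov functional. -/
theorem IsMode.comparable_of_quadratic (h : IsMode a μ T g v z) {s t : ℝ} (hs : 0 ≤ s)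
    (hst : s ≤ t) (ht : t ≤ T) {x y w x' y' w' b : ℝ → ℝ} {c C : ℝ} (hc : 0 < c)
    (hx : ∀ r ∈ Icc s t, HasDerivWithinAt x (x' r) (Icc s t) r)
    (hy : ∀ r ∈ Icc s t, HasDerivWithinAt y (y' r) (Icc s t) r)
    (hw : ∀ r ∈ Icc s t, HasDerivWithinAt w (w' r) (Icc s t) r)
    (hx' : ContinuousOn x' (Icc s t)) (hy' : ContinuousOn y' (Icc s t))
    (hw' : ContinuousOn w' (Icc s t))
    (hlow : ∀ r ∈ Icc s t, ∀ V Z : ℝ, c * (V ^ 2 + Z ^ 2) ≤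
      x r * V ^ 2 + 2 * y r * (V * Z) + w r * Z ^ 2)
    (hup : ∀ r ∈ Icc s t, ∀ V Z : ℝ,
      x r * V ^ 2 + 2 * y r * (V * Z) + w r * Z ^ 2 ≤ C * (V ^ 2 + Z ^ 2))
    (hb : IntervalIntegrable b volume s t) (hb0 : ∀ r ∈ Icc s t, 0 ≤ b r)
    (hder : ∀ r ∈ Icc s t, ∀ V Z : ℝ, |(x' r + 2 * μ * y r) * V ^ 2 +
      2 * (y' r - a r ^ 2 * μ * x r + μ * w r) * (V * Z) +
      (w' r - 2 * μ * a r ^ 2 * y r) * Z ^ 2| ≤ b r * (V ^ 2 + Z ^ 2)) :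
    ModeComparable (4 * C / c * Real.exp ((∫ r in s..t, b r) / c)) g v z s t := by
  have hT : 0 ≤ T := hs.trans (hst.trans ht)
  have hcC : c ≤ C := by
    have h1 := hlow s ⟨le_rfl, hst⟩ 1 0
    have h2 := hup s ⟨le_rfl, hst⟩ 1 0
    norm_num at h1 h2
    linarith
  have hC : 0 < C := hc.trans_le hcC
  have hsub : uIcc s t ⊆ uIcc 0 T := by
    rw [uIcc_of_le hst, uIcc_of_le hT]; exact Icc_subset_Icc hs ht
  have hv := h.ac_v.mono hsub
  have hz := h.ac_z.mono hsub
  set q : ℝ → ℝ := fun r => x r * (v r * v r) + 2 * (y r * (v r * z r)) + w r * (z r * z r) with hq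
  have hqac : AbsolutelyContinuousOnInterval q s t :=
    (((absolutelyContinuousOnInterval_of_hasDerivWithinAt hst hx hx').fun_mul
      (hv.fun_mul hv)).fun_add
      (((absolutelyContinuousOnInterval_of_hasDerivWithinAt hst hy hy').fun_mul
      (hv.fun_mul hz)).const_mul 2)).fun_add
      ((absolutelyContinuousOnInterval_of_hasDerivWithinAt hst hw hw').fun_mul (hz.fun_mul hz))
  have hqlow : ∀ r ∈ Icc s t, c * (v r ^ 2 + z r ^ 2) ≤ q r := fun r hr => by
    have := hlow r hr (v r) (z r); simp only [hq]; nlinarith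
  have hqup : ∀ r ∈ Icc s t, q r ≤ C * (v r ^ 2 + z r ^ 2) := fun r hr => by
    have := hup r hr (v r) (z r); simp only [hq]; nlinarith
  have hwork := h.intervalIntegrable_work hs hst ht
  have hforce : ∀ r ∈ Icc s t, |2 * (y r * v r + w r * z r) * g r| ≤
      4 * C * (√(v r ^ 2 + z r ^ 2) * |g r|) := by
    intro r hr
    rw [abs_mul]
    have hw0 : 0 < w r := by have := hlow r hr 0 1; norm_num at this; linarith
    have hwC : w r ≤ C := by have := hup r hr 0 1; norm_num at this; linarith
    -- The test vectors `(1, 1)` and `(1, -1)` control the off-diagonal entry.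
    have hyC : |y r| ≤ C := by
      have h1 := hup r hr 1 1
      have h2 := hup r hr 1 (-1)
      have h3 := hlow r hr 1 1
      have h4 := hlow r hr 1 (-1)
      have h5 := hlow r hr 1 0
      norm_num at h1 h2 h3 h4 h5
      rw [abs_le]; constructor <;> nlinarith
    have h1 : |v r| ≤ √(v r ^ 2 + z r ^ 2) := Real.abs_le_sqrt (by nlinarith [sq_nonneg (z r)])
    have h2 : |z r| ≤ √(v r ^ 2 + z r ^ 2) := Real.abs_le_sqrt (by nlinarith [sq_nonneg (v r)])
    have h3 : |2 * (y r * v r + w r * z r)| ≤ 4 * C * √(v r ^ 2 + z r ^ 2) := by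
      rw [abs_mul, abs_two]
      have := abs_add_le (y r * v r) (w r * z r)
      rw [abs_mul, abs_mul, abs_of_pos hw0] at this
      nlinarith [mul_le_mul hyC h1 (abs_nonneg _) hC.le, mul_le_mul hwC h2 (abs_nonneg _) hC.le]
    nlinarith [mul_le_mul_of_nonneg_right h3 (abs_nonneg (g r))]
  -- The derivative of `q` is the quadratic form in `hder`, which is the contribution of the
  -- unforced flow, plus `2 (y v + w z) g` from the force.
  have main := gronwall_of_absolutelyContinuous hst hqac (hb.div_const c)
    (fun r hr => div_nonneg (hb0 r hr) hc.le) (hwork.const_mul (4 * C))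
    (fun r _ => by positivity) (by
      filter_upwards [h.deriv_v, h.deriv_z] with r h1 h2 hr
      have hr0 : r ∈ Ioo 0 T := ⟨hs.trans_lt hr.1, hr.2.trans_le ht⟩
      have hr' := Ioo_subset_Icc_self hr
      have hn : Icc s t ∈ nhds r := Icc_mem_nhds hr.1 hr.2
      have hvd := h1 hr0
      have hzd := h2 hr0
      have hxd := (hx r hr').hasDerivAt hn
      have hyd := (hy r hr').hasDerivAt hn
      have hwd := (hw r hr').hasDerivAt hn
      refine ⟨_, ((hxd.mul (hvd.mul hvd)).add ((hyd.mul (hvd.mul hzd)).const_mul 2)).add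
        (hwd.mul (hzd.mul hzd)), ?_⟩
      have e1 := hder r hr' (v r) (z r)
      have e2 := hforce r hr'
      have e3 : b r * (v r ^ 2 + z r ^ 2) ≤ b r / c * q r := by
        rw [div_mul_eq_mul_div, le_div_iff₀ hc]
        nlinarith [mul_le_mul_of_nonneg_left (hqlow r hr') (hb0 r hr')]
      have e4 := abs_add_le ((x' r + 2 * μ * y r) * v r ^ 2 +
        2 * (y' r - a r ^ 2 * μ * x r + μ * w r) * (v r * z r) +
        (w' r - 2 * μ * a r ^ 2 * y r) * z r ^ 2) (2 * (y r * v r + w r * z r) * g r)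
      refine le_trans (le_of_eq ?_) (e4.trans (add_le_add (e1.trans e3) e2))
      congr 1
      simp only [Pi.mul_apply]
      ring)
  rw [intervalIntegral.integral_const_mul, intervalIntegral.integral_div] at main
  have hW : 0 ≤ modeWork g v z s t := modeWork_nonneg hst
  change q t ≤ _ * (q s + 4 * C * modeWork g v z s t) ∧
    q s ≤ _ * (q t + 4 * C * modeWork g v z s t) at main
  have hE := Real.exp_pos ((∫ r in s..t, b r) / c)
  set E := Real.exp ((∫ r in s..t, b r) / c)
  have fin : ∀ e e' Q Q' : ℝ, 0 ≤ e' → c * e ≤ Q → Q' ≤ C * e' →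
      Q ≤ E * (Q' + 4 * C * modeWork g v z s t) →
      e ≤ 4 * C / c * E * (e' + modeWork g v z s t) := by
    intro e e' Q Q' he' h1 h2 h3
    rw [div_mul_eq_mul_div, div_mul_eq_mul_div, le_div_iff₀ hc]
    have h4 : E * (Q' + 4 * C * modeWork g v z s t) ≤
        E * (4 * C * e' + 4 * C * modeWork g v z s t) := by
      gcongr; nlinarith
    nlinarith
  exact ⟨fin _ _ _ _ (by positivity) (hqlow t ⟨hst, le_rfl⟩) (hqup s ⟨le_rfl, hst⟩) main.1,
    fin _ _ _ _ (by positivity) (hqlow s ⟨le_rfl, hst⟩) (hqup t ⟨hst, le_rfl⟩) main.2⟩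

theorem ModeComparable.mono {K K' s t : ℝ} (h : ModeComparable K g v z s t) (hK : K ≤ K')
    (hst : s ≤ t) : ModeComparable K' g v z s t := by
  have hW : 0 ≤ modeWork g v z s t := modeWork_nonneg hst
  exact ⟨h.1.trans (by gcongr), h.2.trans (by gcongr)⟩

/-- The work is additive over adjacent intervals. Constants at least `1` let the work on one
interval be absorbed when the estimate on the other is inserted. -/
theorem IsMode.comparable_trans (h : IsMode a μ T g v z) {r s t K L : ℝ} (hr : 0 ≤ r) (hrs : r ≤ s)
    (hst : s ≤ t) (ht : t ≤ T) (hK : 1 ≤ K) (hL : 1 ≤ L) (h1 : ModeComparable K g v z r s)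
    (h2 : ModeComparable L g v z s t) : ModeComparable (K * L) g v z r t := by
  have hW1 : 0 ≤ modeWork g v z r s := modeWork_nonneg hrs
  have hW2 : 0 ≤ modeWork g v z s t := modeWork_nonneg hst
  have hadd : modeWork g v z r t = modeWork g v z r s + modeWork g v z s t :=
    (intervalIntegral.integral_add_adjacent_intervals
      (h.intervalIntegrable_work hr hrs (hst.trans ht))
      (h.intervalIntegrable_work (hr.trans hrs) hst ht)).symm
  have hK0 : 0 < K := by linarith
  have hL0 : 0 < L := by linarith
  constructor
  · calc v t ^ 2 + z t ^ 2 ≤ L * (v s ^ 2 + z s ^ 2 + modeWork g v z s t) := h2.1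
      _ ≤ L * (K * (v r ^ 2 + z r ^ 2 + modeWork g v z r s) + K * modeWork g v z s t) := by
          gcongr
          · exact h1.1
          · exact le_mul_of_one_le_left hW2 hK
      _ = _ := by rw [hadd]; ring
  · calc v r ^ 2 + z r ^ 2 ≤ K * (v s ^ 2 + z s ^ 2 + modeWork g v z r s) := h1.2
      _ ≤ K * (L * (v t ^ 2 + z t ^ 2 + modeWork g v z s t) + L * modeWork g v z r s) := by
          gcongr
          · exact h2.2
          · exact le_mul_of_one_le_left hW1 hL
      _ = _ := by rw [hadd]; ring

end Mode

/-- All modes of frequency at most `M` obey an energy estimate with the constant `K`. -/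
def ModeBound (a : ℝ → ℝ) (M K : ℝ) : Prop :=
  1 ≤ K ∧ ∀ μ T : ℝ, 0 ≤ μ → μ ≤ M → 0 ≤ T → ∀ g v z : ℝ → ℝ, IsMode a μ T g v z →
    ModeComparable K g v z 0 T


/-! ### Symbol classes in the hyperbolic zone -/

section Symbol

/-- `f'` is the time derivative of the family `f` on `[0, ∞)`. -/
def FamilyDeriv (f f' : ℝ → ℝ → ℝ) : Prop :=
  ∀ μ t, 0 < μ → 0 ≤ t → HasDerivWithinAt (f μ) (f' μ t) (Ici 0) t

/-- `f(μ, t) = O(μ^{-p} Ξ(t)^{-q})` where `μ Ξ(t) ≥ 1`. -/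
def SymbolBound (Ξ : ℝ → ℝ) (p q : ℕ) (f : ℝ → ℝ → ℝ) : Prop :=
  ∃ C, 0 ≤ C ∧ ∀ μ t, 0 < μ → 0 ≤ t → 1 ≤ μ * Ξ t → |f μ t| * (μ ^ p * Ξ t ^ q) ≤ C

/-- Families with `r` continuous time derivatives, each derivative gaining a factor `Ξ^{-1}`. -/
def IsSymbol (Ξ : ℝ → ℝ) : ℕ → ℕ → ℕ → (ℝ → ℝ → ℝ) → Prop
  | 0, p, q, f => (∀ μ, 0 < μ → ContinuousOn (f μ) (Ici 0)) ∧ SymbolBound Ξ p q f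
  | r + 1, p, q, f => SymbolBound Ξ p q f ∧ ∃ f', FamilyDeriv f f' ∧ IsSymbol Ξ r p (q + 1) f'

variable {Ξ : ℝ → ℝ}

theorem SymbolBound.congr {p q : ℕ} {f g : ℝ → ℝ → ℝ} (hf : SymbolBound Ξ p q f)
    (h : ∀ μ t, 0 < μ → 0 ≤ t → f μ t = g μ t) : SymbolBound Ξ p q g := by
  obtain ⟨C, hC, hfC⟩ := hf
  exact ⟨C, hC, fun μ t hμ ht h1 => by rw [← h μ t hμ ht]; exact hfC μ t hμ ht h1⟩

theorem FamilyDeriv.congr {f f' g : ℝ → ℝ → ℝ} (hf : FamilyDeriv f f')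
    (h : ∀ μ t, 0 < μ → 0 ≤ t → f μ t = g μ t) : FamilyDeriv g f' :=
  fun μ t hμ ht => (hf μ t hμ ht).congr (fun s hs => (h μ s hμ hs).symm) (h μ t hμ ht).symm

theorem FamilyDeriv.continuousOn {f f' : ℝ → ℝ → ℝ} (hf : FamilyDeriv f f') {μ : ℝ} (hμ : 0 < μ) :
    ContinuousOn (f μ) (Ici 0) := fun t ht => (hf μ t hμ ht).continuousWithinAt

theorem IsSymbol.bound {r p q : ℕ} {f : ℝ → ℝ → ℝ} (hf : IsSymbol Ξ r p q f) :
    SymbolBound Ξ p q f := by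
  cases r with
  | zero => exact hf.2
  | succ r => exact hf.1

theorem IsSymbol.continuousOn {r p q : ℕ} {f : ℝ → ℝ → ℝ} (hf : IsSymbol Ξ r p q f) {μ : ℝ}
    (hμ : 0 < μ) : ContinuousOn (f μ) (Ici 0) := by
  cases r with
  | zero => exact hf.1 μ hμ
  | succ r => obtain ⟨f', hf', _⟩ := hf.2; exact hf'.continuousOn hμ

theorem IsSymbol.congr {r p q : ℕ} {f g : ℝ → ℝ → ℝ} (hf : IsSymbol Ξ r p q f)
    (h : ∀ μ t, 0 < μ → 0 ≤ t → f μ t = g μ t) : IsSymbol Ξ r p q g := by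
  cases r with
  | zero => exact ⟨fun μ hμ => (hf.1 μ hμ).congr fun t ht => (h μ t hμ ht).symm, hf.2.congr h⟩
  | succ r =>
    obtain ⟨f', hf', hs⟩ := hf.2
    exact ⟨hf.1.congr h, f', hf'.congr h, hs⟩

theorem IsSymbol.of_succ {r p q : ℕ} {f : ℝ → ℝ → ℝ} (hf : IsSymbol Ξ (r + 1) p q f) :
    IsSymbol Ξ r p q f := by
  induction r generalizing q f with
  | zero => exact ⟨fun μ hμ => hf.continuousOn hμ, hf.bound⟩
  | succ r ih =>
    obtain ⟨f', hf', hs⟩ := hf.2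
    exact ⟨hf.1, f', hf', ih hs⟩

theorem IsSymbol.add {r p q : ℕ} {f g : ℝ → ℝ → ℝ} (hΞ : ∀ t, 0 ≤ t → 0 < Ξ t)
    (hf : IsSymbol Ξ r p q f) (hg : IsSymbol Ξ r p q g) :
    IsSymbol Ξ r p q (fun μ t => f μ t + g μ t) := by
  have hb : ∀ {q : ℕ} {f g : ℝ → ℝ → ℝ}, SymbolBound Ξ p q f → SymbolBound Ξ p q g →
      SymbolBound Ξ p q (fun μ t => f μ t + g μ t) := by
    rintro q f g ⟨C, hC, hf⟩ ⟨D, hD, hg⟩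
    refine ⟨C + D, by positivity, fun μ t hμ ht h1 => ?_⟩
    have hw : 0 ≤ μ ^ p * Ξ t ^ q := by have := hΞ t ht; positivity
    have := mul_le_mul_of_nonneg_right (abs_add_le (f μ t) (g μ t)) hw
    linarith [hf μ t hμ ht h1, hg μ t hμ ht h1]
  induction r generalizing q f g with
  | zero => exact ⟨fun μ hμ => (hf.1 μ hμ).add (hg.1 μ hμ), hb hf.2 hg.2⟩
  | succ r ih =>
    obtain ⟨f', hf', hfs⟩ := hf.2
    obtain ⟨g', hg', hgs⟩ := hg.2
    exact ⟨hb hf.1 hg.1, _, fun μ t hμ ht => (hf' μ t hμ ht).add (hg' μ t hμ ht), ih hfs hgs⟩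

theorem IsSymbol.const_mul {r p q : ℕ} {f : ℝ → ℝ → ℝ} (c : ℝ) (hf : IsSymbol Ξ r p q f) :
    IsSymbol Ξ r p q (fun μ t => c * f μ t) := by
  have hb : ∀ {q : ℕ} {f : ℝ → ℝ → ℝ}, SymbolBound Ξ p q f →
      SymbolBound Ξ p q (fun μ t => c * f μ t) := by
    rintro q f ⟨C, hC, hf⟩
    refine ⟨|c| * C, by positivity, fun μ t hμ ht h1 => ?_⟩
    rw [abs_mul, mul_assoc]
    exact mul_le_mul_of_nonneg_left (hf μ t hμ ht h1) (abs_nonneg c)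
  induction r generalizing q f with
  | zero => exact ⟨fun μ hμ => continuousOn_const.mul (hf.1 μ hμ), hb hf.2⟩
  | succ r ih =>
    obtain ⟨f', hf', hfs⟩ := hf.2
    exact ⟨hb hf.1, _, fun μ t hμ ht => (hf' μ t hμ ht).const_mul c, ih hfs⟩

theorem IsSymbol.div_sq {r p q : ℕ} {f : ℝ → ℝ → ℝ} (hf : IsSymbol Ξ r p q f) :
    IsSymbol Ξ r (p + 2) q (fun μ t => f μ t / μ ^ 2) := by
  have hb : ∀ {q : ℕ} {f : ℝ → ℝ → ℝ}, SymbolBound Ξ p q f →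
      SymbolBound Ξ (p + 2) q (fun μ t => f μ t / μ ^ 2) := by
    rintro q f ⟨C, hC, hf⟩
    refine ⟨C, hC, fun μ t hμ ht h1 => le_trans (le_of_eq ?_) (hf μ t hμ ht h1)⟩
    rw [abs_div, abs_of_pos (pow_pos hμ 2)]
    field_simp
    ring
  induction r generalizing q f with
  | zero => exact ⟨fun μ hμ => (hf.1 μ hμ).div_const _, hb hf.2⟩
  | succ r ih =>
    obtain ⟨f', hf', hfs⟩ := hf.2
    exact ⟨hb hf.1, _, fun μ t hμ ht => (hf' μ t hμ ht).div_const _, ih hfs⟩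

/-- Bounds are required only where `μ Ξ ≥ 1`, so surplus factors `(μ Ξ)^{-k}` may be discarded. -/
theorem IsSymbol.lower {r p q : ℕ} {f : ℝ → ℝ → ℝ} (hΞ : ∀ t, 0 ≤ t → 0 < Ξ t) (k : ℕ)
    (hf : IsSymbol Ξ r (p + k) (q + k) f) : IsSymbol Ξ r p q f := by
  have hb : ∀ {q : ℕ} {f : ℝ → ℝ → ℝ}, SymbolBound Ξ (p + k) (q + k) f →
      SymbolBound Ξ p q f := by
    rintro q f ⟨C, hC, hf⟩
    refine ⟨C, hC, fun μ t hμ ht h1 => le_trans ?_ (hf μ t hμ ht h1)⟩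
    have h2 := hΞ t ht
    have e : μ ^ (p + k) * Ξ t ^ (q + k) = (μ ^ p * Ξ t ^ q) * (μ * Ξ t) ^ k := by ring
    rw [e]
    exact mul_le_mul_of_nonneg_left
      (le_mul_of_one_le_right (by positivity) (one_le_pow₀ h1)) (abs_nonneg _)
  induction r generalizing q f with
  | zero => exact ⟨hf.1, hb hf.2⟩
  | succ r ih =>
    obtain ⟨f', hf', hfs⟩ := hf.2
    refine ⟨hb hf.1, f', hf', ih ?_⟩
    rwa [add_right_comm]

theorem IsSymbol.mul {r p q p' q' : ℕ} {f g : ℝ → ℝ → ℝ} (hΞ : ∀ t, 0 ≤ t → 0 < Ξ t)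
    (hf : IsSymbol Ξ r p q f) (hg : IsSymbol Ξ r p' q' g) :
    IsSymbol Ξ r (p + p') (q + q') (fun μ t => f μ t * g μ t) := by
  have hb : ∀ {q q' : ℕ} {f g : ℝ → ℝ → ℝ}, SymbolBound Ξ p q f → SymbolBound Ξ p' q' g →
      SymbolBound Ξ (p + p') (q + q') (fun μ t => f μ t * g μ t) := by
    rintro q q' f g ⟨C, hC, hf⟩ ⟨D, hD, hg⟩
    refine ⟨C * D, by positivity, fun μ t hμ ht h1 => ?_⟩
    have h2 := hΞ t ht
    calc _ = (|f μ t| * (μ ^ p * Ξ t ^ q)) * (|g μ t| * (μ ^ p' * Ξ t ^ q')) := by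
          rw [abs_mul]; ring
      _ ≤ C * D := mul_le_mul (hf μ t hμ ht h1) (hg μ t hμ ht h1) (by positivity) hC
  induction r generalizing q q' f g with
  | zero => exact ⟨fun μ hμ => (hf.1 μ hμ).mul (hg.1 μ hμ), hb hf.2 hg.2⟩
  | succ r ih =>
    have hf0 := hf.of_succ
    have hg0 := hg.of_succ
    obtain ⟨f', hf', hfs⟩ := hf.2
    obtain ⟨g', hg', hgs⟩ := hg.2
    refine ⟨hb hf.1 hg.1, _, fun μ t hμ ht => (hf' μ t hμ ht).mul (hg' μ t hμ ht), ?_⟩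
    have h1 := ih hfs hg0
    have h2 := ih hf0 hgs
    rw [add_right_comm] at h1
    exact h1.add hΞ h2

theorem IsSymbol.inv {r : ℕ} {a : ℝ → ℝ} {a₀ : ℝ} (ha₀ : 0 < a₀) (ha : ∀ t, 0 ≤ t → a₀ ≤ a t)
    (hΞ : ∀ t, 0 ≤ t → 0 < Ξ t) (h : IsSymbol Ξ r 0 0 (fun _ => a)) :
    IsSymbol Ξ r 0 0 (fun _ t => (a t)⁻¹) := by
  have hpos : ∀ t, 0 ≤ t → 0 < a t := fun t ht => ha₀.trans_le (ha t ht)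
  have hb : SymbolBound Ξ 0 0 (fun _ t => (a t)⁻¹) := by
    refine ⟨a₀⁻¹, by positivity, fun μ t _ ht _ => ?_⟩
    have := hpos t ht
    rw [abs_of_pos (by positivity)]
    simpa using inv_anti₀ ha₀ (ha t ht)
  induction r with
  | zero => exact ⟨fun μ hμ => (h.1 μ hμ).inv₀ fun t ht => (hpos t ht).ne', hb⟩
  | succ r ih =>
    have hi := ih h.of_succ
    obtain ⟨a', ha', hs⟩ := h.2
    refine ⟨hb, _, fun μ t hμ ht => (ha' μ t hμ ht).inv (hpos t ht).ne', ?_⟩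
    exact ((hs.mul hΞ (hi.mul hΞ hi)).const_mul (-1)).congr fun μ t _ ht => by
      have := (hpos t ht).ne'
      field_simp

/-- The shift `k` lets the induction pass from `f` to its derivative. -/
theorem isSymbol_of_contDiffOn {r k : ℕ} {f : ℝ → ℝ} (hΞ : ∀ t, 0 ≤ t → 0 < Ξ t)
    (hf : ContDiffOn ℝ r f (Ici 0))
    (hb : ∀ j ≤ r, ∃ C, ∀ t, 0 ≤ t →
      |iteratedDerivWithin j f (Ici 0) t| ≤ C * (Ξ t ^ (k + j))⁻¹) :
    IsSymbol Ξ r 0 k (fun _ => f) := by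
  have hbd : ∀ {k : ℕ} {f : ℝ → ℝ}, (∃ C, ∀ t, 0 ≤ t → |f t| ≤ C * (Ξ t ^ k)⁻¹) →
      SymbolBound Ξ 0 k (fun _ => f) := by
    rintro k f ⟨C, hC⟩
    refine ⟨|C|, abs_nonneg C, fun μ t _ ht _ => ?_⟩
    have h1 := hΞ t ht
    have h2 := hC t ht
    rw [← div_eq_mul_inv, le_div_iff₀ (by positivity)] at h2
    simpa using h2.trans (le_abs_self C)
  induction r generalizing f k with
  | zero => exact ⟨fun μ _ => hf.continuousOn, hbd (by simpa using hb 0 le_rfl)⟩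
  | succ r ih =>
    refine ⟨hbd (by simpa using hb 0 (Nat.zero_le _)), fun _ => derivWithin f (Ici 0), ?_, ?_⟩
    · intro μ t _ ht
      exact ((hf.differentiableOn (by simp)) t ht).hasDerivWithinAt
    · refine ih ?_ fun j hj => ?_
      · exact hf.derivWithin (uniqueDiffOn_Ici 0) (by norm_cast)
      · obtain ⟨C, hC⟩ := hb (j + 1) (by lia)
        refine ⟨C, fun t ht => ?_⟩
        rw [← iteratedDerivWithin_succ']
        have := hC t ht
        rwa [show k + (j + 1) = k + 1 + j by ring] at this

/-! ### Approximate adiabatic invariants -/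

/-- The quadratic expression whose constancy makes `X` generate an exact invariant. -/
noncomputable def wkbForm (a : ℝ → ℝ) (X X₁ X₂ : ℝ → ℝ → ℝ) (μ t : ℝ) : ℝ :=
  a t ^ 2 * X μ t ^ 2 + X μ t * X₂ μ t / (2 * μ ^ 2) - X₁ μ t ^ 2 / (4 * μ ^ 2)

/-- WKB iteration. The starting point `X = 1/a` solves `a² X² = 1`, so only the terms with `μ^{-2}`
are left as a defect. Each correction improves the defect by `(μ Ξ)^{-2}` and costs two derivatives
of `a`, which is why `r + 2 L + 2` of them are required. -/
theorem exists_wkb {a : ℝ → ℝ} {a₀ : ℝ} (ha₀ : 0 < a₀) (ha : ∀ t, 0 ≤ t → a₀ ≤ a t)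
    (hΞ : ∀ t, 0 ≤ t → 0 < Ξ t) (L r : ℕ) (h : IsSymbol Ξ (r + 2 * L + 2) 0 0 (fun _ => a)) :
    ∃ X X₁ X₂ : ℝ → ℝ → ℝ, FamilyDeriv X X₁ ∧ FamilyDeriv X₁ X₂ ∧
      IsSymbol Ξ (r + 2) 2 2 (fun μ t => X μ t - (a t)⁻¹) ∧
      IsSymbol Ξ (r + 1) 0 1 X₁ ∧ IsSymbol Ξ r 0 2 X₂ ∧
      IsSymbol Ξ r (2 * L + 2) (2 * L + 2) (fun μ t => 1 - wkbForm a X X₁ X₂ μ t) := by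
  have hpos : ∀ t, 0 ≤ t → a t ≠ 0 := fun t ht => (ha₀.trans_le (ha t ht)).ne'
  induction L generalizing r with
  | zero =>
    have hi := h.inv ha₀ ha hΞ
    obtain ⟨X₁, hX₁, h1⟩ := hi.2
    obtain ⟨X₂, hX₂, h2⟩ := h1.2
    refine ⟨fun _ t => (a t)⁻¹, X₁, X₂, hX₁, hX₂, ?_, h1, h2, ?_⟩
    · have h0 : IsSymbol Ξ (r + 2) 2 2 (fun μ t => 0 * ((a t)⁻¹ * (0 : ℝ))) := by
        have hz : ∀ n q, IsSymbol Ξ n 2 q (fun _ _ => (0 : ℝ)) := by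
          intro n
          induction n with
          | zero => exact fun q => ⟨fun μ _ => continuousOn_const, 0, le_rfl, by simp⟩
          | succ n ih =>
            exact fun q => ⟨⟨0, le_rfl, by simp⟩, _,
              fun μ t _ _ => hasDerivWithinAt_const _ _ _, ih _⟩
        simpa using hz (r + 2) 2
      exact h0.congr fun μ t _ _ => by simp
    · have e1 := ((hi.of_succ.of_succ.mul hΞ h2).div_sq).const_mul (-(1 / 2))
      have e2 := ((h1.of_succ.mul hΞ h1.of_succ).div_sq).const_mul (1 / 4)
      refine (e1.add hΞ e2).congr fun μ t hμ ht => ?_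
      have := hpos t ht
      simp only [wkbForm]
      field_simp
      ring
  | succ L ih =>
    obtain ⟨X, X₁, X₂, hX, hX₁, h0, h1, h2, hK⟩ := ih (r + 2) (by convert! h using 1; ring)
    have hA : IsSymbol Ξ (r + 2) 0 0 (fun _ => a) := by
      have hlow : ∀ k, IsSymbol Ξ (r + 2 + k) 0 0 (fun _ => a) →
          IsSymbol Ξ (r + 2) 0 0 (fun _ => a) := by
        intro k
        induction k with
        | zero => exact id
        | succ k ih => exact fun h => ih h.of_succ
      exact hlow (2 * (L + 1)) (by convert! h using 1; ring)
    have hAi := hA.inv ha₀ ha hΞ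
    have hδ : IsSymbol Ξ (r + 2) (2 * L + 2) (2 * L + 2)
        (fun μ t => 1 / 2 * ((a t)⁻¹ * (1 - wkbForm a X X₁ X₂ μ t))) := by
      have := (hAi.mul hΞ hK).const_mul (1 / 2)
      rwa [zero_add] at this
    -- A Newton step: the linearisation of `a² X²` at `1/a` is multiplication by `2a`, so adding `δ
    -- = defect / (2a)` cancels the defect to leading order.
    set δ : ℝ → ℝ → ℝ := fun μ t => 1 / 2 * ((a t)⁻¹ * (1 - wkbForm a X X₁ X₂ μ t)) with hδdef
    obtain ⟨δ₁, hδ₁, s1⟩ := hδ.2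
    obtain ⟨δ₂, hδ₂, s2⟩ := s1.2
    have ep : 2 * L + 2 = 2 + 2 * L := by ring
    have hδ' : IsSymbol Ξ (r + 2) 2 2 δ := by
      have h := hδ; rw [ep] at h; exact h.lower hΞ (2 * L)
    refine ⟨fun μ t => X μ t + δ μ t, fun μ t => X₁ μ t + δ₁ μ t, fun μ t => X₂ μ t + δ₂ μ t,
      fun μ t hμ ht => (hX μ t hμ ht).add (hδ₁ μ t hμ ht),
      fun μ t hμ ht => (hX₁ μ t hμ ht).add (hδ₂ μ t hμ ht), ?_, ?_, ?_, ?_⟩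
    · exact (h0.of_succ.of_succ.add hΞ hδ').congr fun μ t _ _ => by ring
    · refine h1.of_succ.of_succ.add hΞ ?_
      have := s1
      rw [show 2 * L + 2 = 0 + (2 * L + 2) by ring,
        show 0 + (2 * L + 2) + 1 = 1 + (2 * L + 2) by ring] at this
      exact this.lower hΞ (2 * L + 2)
    · refine h2.of_succ.of_succ.add hΞ ?_
      have := s2
      rw [show 2 * L + 2 = 0 + (2 * L + 2) by ring,
        show 0 + (2 * L + 2) + 1 + 1 = 2 + (2 * L + 2) by ring] at this
      exact this.lower hΞ (2 * L + 2)
    · set p := 2 * L + 2 with hp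
      have hA0 := hA.of_succ.of_succ
      have hA2 := hA0.mul hΞ hA0
      have d0 := hδ.of_succ.of_succ
      have d1 := s1.of_succ
      have x0 := h0.of_succ.of_succ.of_succ.of_succ
      have x1 := h1.of_succ.of_succ.of_succ
      have x2 := h2.of_succ.of_succ
      have xx : IsSymbol Ξ r 0 0 X :=
        ((IsSymbol.lower (p := 0) (q := 0) hΞ 2 x0).add hΞ hAi.of_succ.of_succ).congr
          fun μ t _ _ => by ring
      have d2 := s2
      have d0' : IsSymbol Ξ r 2 2 δ := hδ'.of_succ.of_succ
      have d1' : IsSymbol Ξ r 0 1 δ₁ := by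
        have := d1
        rw [show p = 0 + p by ring, show 0 + p + 1 = 1 + p by ring] at this
        exact this.lower hΞ p
      have dd : IsSymbol Ξ r 0 0 δ := IsSymbol.lower (p := 0) (q := 0) hΞ 2 d0'
      have fix : ∀ {i j : ℕ} {f : ℝ → ℝ → ℝ}, IsSymbol Ξ r i j f → i = p + 2 → j = p + 2 →
          IsSymbol Ξ r (2 * (L + 1) + 2) (2 * (L + 1) + 2) f := by
        intro i j f hf hi hj
        have e : 2 * (L + 1) + 2 = p + 2 := by rw [hp]; ring
        rw [e, ← hi]; rw [hj, ← hi] at hf; exact hf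
      -- The new defect is a sum of seven terms. The first is `2aδ - 2a²Xδ = -2a²(X - 1/a)δ`, small
      -- because `X` is close to `1/a`. The second is quadratic in `δ`, and the others carry
      -- `μ^{-2}` with two time derivatives.
      have t1 := fix ((hA2.mul hΞ (x0.mul hΞ d0)).const_mul (-2)) (by ring) (by ring)
      have t2 := fix ((hA2.mul hΞ (d0'.mul hΞ d0)).const_mul (-1)) (by ring) (by ring)
      have t3 := fix (((xx.mul hΞ d2).div_sq).const_mul (-(1 / 2))) (by ring) (by ring)
      have t4 := fix (((d0.mul hΞ x2).div_sq).const_mul (-(1 / 2))) (by ring) (by ring)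
      have t5 := fix (((dd.mul hΞ d2).div_sq).const_mul (-(1 / 2))) (by ring) (by ring)
      have t6 := fix (((x1.mul hΞ d1).div_sq).const_mul (1 / 2)) (by ring) (by ring)
      have t7 := fix (((d1'.mul hΞ d1).div_sq).const_mul (1 / 4)) (by ring) (by ring)
      refine ((((((t1.add hΞ t2).add hΞ t3).add hΞ t4).add hΞ t5).add hΞ t6).add hΞ t7).congr
        fun μ t hμ ht => ?_
      have hδe : 1 - wkbForm a X X₁ X₂ μ t = 2 * a t * δ μ t := by
        have := hpos t ht
        simp only [hδdef]
        field_simp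
      have ea := hpos t ht
      have hw : 1 - wkbForm a (fun μ t => X μ t + δ μ t) (fun μ t => X₁ μ t + δ₁ μ t)
          (fun μ t => X₂ μ t + δ₂ μ t) μ t = (1 - wkbForm a X X₁ X₂ μ t) -
          (a t ^ 2 * (2 * X μ t * δ μ t + δ μ t ^ 2) +
          (X μ t * δ₂ μ t + δ μ t * X₂ μ t + δ μ t * δ₂ μ t) / (2 * μ ^ 2) -
          (2 * X₁ μ t * δ₁ μ t + δ₁ μ t ^ 2) / (4 * μ ^ 2)) := by
        simp only [wkbForm]
        ring
      rw [hw, hδe]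
      field_simp
      ring


end Symbol

/-! ### Energy estimates for modes -/

theorem one_le_comparison_constant {c C b : ℝ} (hc : 0 < c) (hcC : c ≤ C) (hb : 0 ≤ b) :
    1 ≤ 4 * C / c * Real.exp (b / c) := by
  have h1 : 1 ≤ 4 * C / c := by rw [le_div_iff₀ hc]; linarith
  have h2 : 1 ≤ Real.exp (b / c) := Real.one_le_exp (by positivity)
  nlinarith

/-! ### Frozen-coefficient and instantaneous energies: the stabilised zone and cases (i) and (ii).
-/

section Coefficient

variable {a : ℝ → ℝ} {a₀ a₁ : ℝ}

theorem intervalIntegrable_abs_sub (ha_meas : AEMeasurable a (volume.restrict (Ici 0)))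
    (ha₀ : 0 < a₀) (ha : ∀ t, 0 ≤ t → a₀ ≤ a t ∧ a t ≤ a₁) (c : ℝ) {s t : ℝ} (hs : 0 ≤ s)
    (hst : s ≤ t) : IntervalIntegrable (fun r => |a r - c|) volume s t := by
  rw [intervalIntegrable_iff_integrableOn_Ioc_of_le hst]
  have hsub : Ioc s t ⊆ Ici 0 := fun r hr => hs.trans hr.1.le
  have hm : AEMeasurable (fun r => |a r - c|) (volume.restrict (Ioc s t)) :=
    ((ha_meas.mono_measure (Measure.restrict_mono hsub le_rfl)).sub_const c).abs
  refine Integrable.of_bound hm.aestronglyMeasurable (a₁ + |c|) ?_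
  rw [ae_restrict_iff' measurableSet_Ioc]
  refine Filter.Eventually.of_forall fun r hr => ?_
  have h := ha r (hsub hr)
  rw [Real.norm_eq_abs, abs_abs]
  refine (abs_sub _ _).trans ?_
  rw [abs_of_pos (ha₀.trans_le h.1)]
  linarith [h.2]

/-- The constant of the energy estimate in the zone where the coefficient is stabilized. -/
noncomputable def stabConst (a₁ aInf N : ℝ) : ℝ :=
  4 * max 1 (aInf ^ 2) / min 1 (aInf ^ 2) * Real.exp ((a₁ + aInf) * N / min 1 (aInf ^ 2))

theorem one_le_stabConst {aInf N : ℝ} (h : 0 < aInf) (ha₁ : 0 ≤ a₁) (hN : 0 ≤ N) :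
    1 ≤ stabConst a₁ aInf N :=
  one_le_comparison_constant (by positivity) (min_le_max) (by positivity)

/-- The Lyapunov form is the conserved energy `V² + a∞² Z²` of the oscillator with coefficient `a∞`.
Its rate of change `-2μ (a² - a∞²) V Z` integrates to at most a multiple of `μ ∫ |a - a∞| ≤ N`. -/
theorem IsMode.comparable_of_stabilization
    (ha_meas : AEMeasurable a (volume.restrict (Ici 0))) (ha₀ : 0 < a₀)
    (ha : ∀ t, 0 ≤ t → a₀ ≤ a t ∧ a t ≤ a₁) {μ T : ℝ} {g v z : ℝ → ℝ} (h : IsMode a μ T g v z)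
    (hμ : 0 ≤ μ) {aInf : ℝ} (hInf : 0 < aInf) {t N : ℝ} (ht : 0 ≤ t) (htT : t ≤ T)
    (hN : μ * ∫ r in (0 : ℝ)..t, |a r - aInf| ≤ N) :
    ModeComparable (stabConst a₁ aInf N) g v z 0 t := by
  have ha₁ : 0 ≤ a₁ := by have := ha 0 le_rfl; linarith
  have hint := intervalIntegrable_abs_sub ha_meas ha₀ ha aInf le_rfl ht
  have hc : 0 < min 1 (aInf ^ 2) := by positivity
  have key := h.comparable_of_quadratic (x := fun _ => 1) (y := fun _ => 0)
    (w := fun _ => aInf ^ 2) (x' := fun _ => 0) (y' := fun _ => 0) (w' := fun _ => 0)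
    (b := fun r => μ * (a₁ + aInf) * |a r - aInf|) (C := max 1 (aInf ^ 2)) le_rfl ht htT hc
    (fun r _ => hasDerivWithinAt_const _ _ _) (fun r _ => hasDerivWithinAt_const _ _ _)
    (fun r _ => hasDerivWithinAt_const _ _ _) continuousOn_const continuousOn_const
    continuousOn_const
    (fun r _ V Z => by
      nlinarith [min_le_left 1 (aInf ^ 2), min_le_right 1 (aInf ^ 2), sq_nonneg V, sq_nonneg Z])
    (fun r _ V Z => by
      nlinarith [le_max_left 1 (aInf ^ 2), le_max_right 1 (aInf ^ 2), sq_nonneg V, sq_nonneg Z])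
    (hint.const_mul _) (fun r _ => by positivity)
    (fun r hr V Z => by
      have har := ha r hr.1
      have e : (0 + 2 * μ * 0) * V ^ 2 + 2 * (0 - a r ^ 2 * μ * 1 + μ * aInf ^ 2) * (V * Z) +
          (0 - 2 * μ * a r ^ 2 * 0) * Z ^ 2 =
          -(μ * (a r - aInf) * (a r + aInf) * (2 * (V * Z))) := by ring
      rw [e, abs_neg, abs_mul, abs_mul, abs_mul, abs_of_nonneg hμ,
        abs_of_nonneg (show 0 ≤ a r + aInf by linarith)]
      have h1 : |2 * (V * Z)| ≤ V ^ 2 + Z ^ 2 := by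
        rw [abs_le]; constructor <;> nlinarith [sq_nonneg (V - Z), sq_nonneg (V + Z)]
      calc _ ≤ μ * |a r - aInf| * (a₁ + aInf) * (V ^ 2 + Z ^ 2) := by
            gcongr; exact har.2
        _ = _ := by ring)
  refine key.mono ?_ ht
  rw [intervalIntegral.integral_const_mul, stabConst]
  have : μ * (a₁ + aInf) * ∫ r in (0 : ℝ)..t, |a r - aInf| ≤ (a₁ + aInf) * N := by
    nlinarith [mul_le_mul_of_nonneg_left hN (show 0 ≤ a₁ + aInf by linarith)]
  gcongr

/-- Frequencies are bounded by `M`, so `μ ∫ |a - a∞|` is bounded over all times and the stabilised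
zone is everything. -/
theorem exists_modeBound_of_stabilizes_of_bddAbove
    (ha_meas : AEMeasurable a (volume.restrict (Ici 0))) (ha₀ : 0 < a₀)
    (ha : ∀ t, 0 ≤ t → a₀ ≤ a t ∧ a t ≤ a₁) {Θ : ℝ → ℝ} (hΘ : Stabilizes a Θ)
    (hbdd : BddAbove (Θ '' Ici 0)) (M : ℝ) : ∃ K, ModeBound a M K := by
  obtain ⟨aInf, hInf, hst⟩ := hΘ
  obtain ⟨B, hB⟩ := hbdd
  have ha₁ : 0 ≤ a₁ := by have := ha 0 le_rfl; linarith
  refine ⟨stabConst a₁ aInf (|M| * |B|), one_le_stabConst hInf ha₁ (by positivity),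
    fun μ T hμ hM hT g v z h =>
      h.comparable_of_stabilization ha_meas ha₀ ha hμ hInf hT le_rfl ?_⟩
  have h1 : ∫ r in (0 : ℝ)..T, |a r - aInf| ≤ |B| :=
    (hst T hT).trans ((hB (mem_image_of_mem Θ hT)).trans (le_abs_self B))
  exact mul_le_mul (hM.trans (le_abs_self M)) h1
    (intervalIntegral.integral_nonneg hT fun r _ => abs_nonneg _) (abs_nonneg M)

theorem intervalIntegrable_of_integrableOn_Ici {f : ℝ → ℝ} (hf : IntegrableOn f (Ici 0))
    {s t : ℝ} (hs : 0 ≤ s) (hst : s ≤ t) : IntervalIntegrable f volume s t := by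
  rw [intervalIntegrable_iff_integrableOn_Ioc_of_le hst]
  exact hf.mono_set fun r hr => hs.trans hr.1.le

/-- For the form `V² + a² Z²` the terms containing `μ` cancel. What remains is `2 a a' Z²`, with an
integrable coefficient. -/
theorem exists_modeBound_of_derivBounds_one (ha₀ : 0 < a₀)
    (ha : ∀ t, 0 ≤ t → a₀ ≤ a t ∧ a t ≤ a₁) {Ξ : ℝ → ℝ} (hΞ : PosMono Ξ)
    (hd : DerivBounds 1 a Ξ) (hint : IntegrableOn (fun t => (Ξ t)⁻¹) (Ici 0)) (M : ℝ) :
    ∃ K, ModeBound a M K := by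
  obtain ⟨-, hcd, hb⟩ := hd
  obtain ⟨C₁, hC₁, hC₁b⟩ := hb 1 le_rfl le_rfl
  have ha₁ : 0 < a₁ := by have := ha 0 le_rfl; linarith
  have hda : ∀ t, 0 ≤ t → HasDerivWithinAt a (derivWithin a (Ici 0) t) (Ici 0) t := fun t ht =>
    (hcd.differentiableOn (by simp) t ht).hasDerivWithinAt
  have hdc : ContinuousOn (derivWithin a (Ici 0)) (Ici 0) :=
    hcd.continuousOn_derivWithin (uniqueDiffOn_Ici 0) (by simp)
  set J := ∫ r in Ici (0 : ℝ), (Ξ r)⁻¹ with hJ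
  have hJ0 : 0 ≤ J := setIntegral_nonneg measurableSet_Ici fun r hr =>
    (inv_pos.2 (hΞ.1 r hr)).le
  have hcpos : 0 < min 1 (a₀ ^ 2) := by positivity
  have hcC : min 1 (a₀ ^ 2) ≤ max 1 (a₁ ^ 2) := (min_le_left _ _).trans (le_max_left _ _)
  refine ⟨4 * max 1 (a₁ ^ 2) / min 1 (a₀ ^ 2) * Real.exp (2 * a₁ * C₁ * J / min 1 (a₀ ^ 2)),
    one_le_comparison_constant hcpos hcC (by positivity), fun μ T hμ _ hT g v z h => ?_⟩
  have hsub : Icc 0 T ⊆ Ici 0 := Icc_subset_Ici_self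
  have hac : ContinuousOn a (Icc 0 T) := hcd.continuousOn.mono hsub
  have hIi := intervalIntegrable_of_integrableOn_Ici hint le_rfl hT
  have key := h.comparable_of_quadratic (x := fun _ => 1) (y := fun _ => 0)
    (w := fun r => a r ^ 2) (x' := fun _ => 0) (y' := fun _ => 0)
    (w' := fun r => 2 * a r * derivWithin a (Ici 0) r)
    (b := fun r => 2 * a₁ * C₁ * (Ξ r)⁻¹) (C := max 1 (a₁ ^ 2)) le_rfl hT le_rfl hcpos
    (fun r _ => hasDerivWithinAt_const _ _ _) (fun r _ => hasDerivWithinAt_const _ _ _)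
    (fun r hr => by simpa using ((hda r hr.1).mono hsub).fun_pow 2)
    continuousOn_const continuousOn_const
    ((continuousOn_const.mul hac).mul (hdc.mono hsub))
    (fun r hr V Z => by
      have har := ha r hr.1
      have : a₀ ^ 2 ≤ a r ^ 2 := by gcongr; exact har.1
      nlinarith [min_le_left 1 (a₀ ^ 2), min_le_right 1 (a₀ ^ 2), sq_nonneg V, sq_nonneg Z])
    (fun r hr V Z => by
      have har := ha r hr.1
      have : a r ^ 2 ≤ a₁ ^ 2 := by
        have : 0 ≤ a r := by linarith
        gcongr; exact har.2
      nlinarith [le_max_left 1 (a₁ ^ 2), le_max_right 1 (a₁ ^ 2), sq_nonneg V, sq_nonneg Z])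
    (hIi.const_mul _) (fun r hr => by have := hΞ.1 r hr.1; positivity)
    (fun r hr V Z => by
      have har := ha r hr.1
      have har0 : 0 ≤ a r := by linarith
      have hΞr := hΞ.1 r hr.1
      have e : (0 + 2 * μ * 0) * V ^ 2 + 2 * (0 - a r ^ 2 * μ * 1 + μ * a r ^ 2) * (V * Z) +
          (2 * a r * derivWithin a (Ici 0) r - 2 * μ * a r ^ 2 * 0) * Z ^ 2 =
          2 * a r * derivWithin a (Ici 0) r * Z ^ 2 := by ring
      have h1 : |derivWithin a (Ici 0) r| ≤ C₁ * (Ξ r)⁻¹ := by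
        have := hC₁b r hr.1
        rwa [iteratedDerivWithin_one, pow_one] at this
      rw [e, abs_mul, abs_mul, abs_of_nonneg (show 0 ≤ 2 * a r by linarith),
        abs_of_nonneg (sq_nonneg Z)]
      calc _ ≤ 2 * a₁ * (C₁ * (Ξ r)⁻¹) * (V ^ 2 + Z ^ 2) := by
            gcongr
            · exact har.2
            · nlinarith [sq_nonneg V]
        _ = _ := by ring)
  refine key.mono ?_ hT
  rw [intervalIntegral.integral_const_mul]
  have : ∫ r in (0 : ℝ)..T, (Ξ r)⁻¹ ≤ J := by
    rw [intervalIntegral.integral_of_le hT]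
    refine setIntegral_mono_set hint ?_ ?_
    · rw [Filter.EventuallyLE, ae_restrict_iff' measurableSet_Ici]
      exact Filter.Eventually.of_forall fun r hr => (inv_pos.2 (hΞ.1 r hr)).le
    · exact (show Ioc 0 T ⊆ Ici 0 from fun r hr => hr.1.le).eventuallyLE
  gcongr

end Coefficient

/-- The form has determinant `D`. Completing the square gives `x (V + (y/x) Z)² + (D/x) Z²`, so
coercivity follows from lower bounds on `x` and `D`. -/
theorem form_bounds {x y D x₀ x₁ : ℝ} (hx₀ : 0 < x₀) (h₀ : x₀ ≤ x) (h₁ : x ≤ x₁) (hy : |y| ≤ 1)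
    (hD : 1 / 2 ≤ D) (hD' : D ≤ 2) (V Z : ℝ) :
    (2 * x₁ + 2 / x₀ + 4 * x₁ / x₀ ^ 2)⁻¹ * (V ^ 2 + Z ^ 2) ≤
      x * V ^ 2 + 2 * y * (V * Z) + (D + y ^ 2) / x * Z ^ 2 ∧
    x * V ^ 2 + 2 * y * (V * Z) + (D + y ^ 2) / x * Z ^ 2 ≤
      (x₁ + 1 + 3 / x₀) * (V ^ 2 + Z ^ 2) := by
  have hx : 0 < x := hx₀.trans_le h₀
  have hx₁ : 0 < x₁ := hx.trans_le h₁
  have hy2 : y ^ 2 ≤ 1 := by rw [← sq_abs]; nlinarith [abs_nonneg y]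
  constructor
  · set U := V + y / x * Z with hU
    have hq : x * V ^ 2 + 2 * y * (V * Z) + (D + y ^ 2) / x * Z ^ 2 = x * U ^ 2 + D / x * Z ^ 2 := by
      rw [hU]; field_simp; ring
    rw [hq]
    set q := x * U ^ 2 + D / x * Z ^ 2 with hqd
    have hDx : 1 / (2 * x₁) ≤ D / x := by
      rw [div_le_div_iff₀ (by positivity) hx]; nlinarith
    have hZ : Z ^ 2 ≤ 2 * x₁ * q := by
      have h1 : 1 / (2 * x₁) * Z ^ 2 ≤ q := by
        have := mul_le_mul_of_nonneg_right hDx (sq_nonneg Z)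
        have : 0 ≤ x * U ^ 2 := by positivity
        linarith
      rw [div_mul_eq_mul_div, div_le_iff₀ (by positivity)] at h1
      linarith
    have hUq : U ^ 2 ≤ q / x₀ := by
      rw [le_div_iff₀ hx₀]
      have : 0 ≤ D / x * Z ^ 2 := by positivity
      nlinarith [mul_le_mul_of_nonneg_right h₀ (sq_nonneg U)]
    have hyx : (y / x) ^ 2 ≤ 1 / x₀ ^ 2 := by
      rw [div_pow]; gcongr
    have hV : V ^ 2 ≤ 2 * U ^ 2 + 2 * (y / x) ^ 2 * Z ^ 2 := by
      have e : V = U - y / x * Z := by rw [hU]; ring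
      rw [e]; nlinarith [sq_nonneg (U + y / x * Z)]
    have hV2 : V ^ 2 ≤ 2 * (q / x₀) + 2 * (1 / x₀ ^ 2) * (2 * x₁ * q) := by
      refine hV.trans ?_
      gcongr
    rw [inv_mul_le_iff₀ (by positivity)]
    have e : (2 * x₁ + 2 / x₀ + 4 * x₁ / x₀ ^ 2) * q =
        2 * x₁ * q + (2 * (q / x₀) + 2 * (1 / x₀ ^ 2) * (2 * x₁ * q)) := by
      field_simp
      ring
    rw [e]; linarith
  · have hw : (D + y ^ 2) / x ≤ 3 / x₀ := by
      gcongr; linarith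
    have h2 : 2 * y * (V * Z) ≤ V ^ 2 + Z ^ 2 := by
      have := abs_le.1 hy
      nlinarith [sq_nonneg (V - Z), sq_nonneg (V + Z), sq_nonneg (V - y * Z),
        mul_nonneg (sq_nonneg Z) (show 0 ≤ 1 - y ^ 2 by linarith)]
    have h3 : 0 ≤ 3 / x₀ := by positivity
    nlinarith [mul_le_mul_of_nonneg_right hw (sq_nonneg Z),
      mul_le_mul_of_nonneg_right h₁ (sq_nonneg V), sq_nonneg V, sq_nonneg Z,
      mul_nonneg h3 (sq_nonneg V), mul_nonneg hx₁.le (sq_nonneg Z)]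

/-- Approximate invariants to order `m`, in the form used by the Lyapunov functional. -/
theorem exists_wkb_of_order {a Ξ : ℝ → ℝ} {a₀ : ℝ} (ha₀ : 0 < a₀) (ha : ∀ t, 0 ≤ t → a₀ ≤ a t)
    (hΞ : ∀ t, 0 ≤ t → 0 < Ξ t) {m : ℕ} (hm : 2 ≤ m) (h : IsSymbol Ξ m 0 0 (fun _ => a)) :
    ∃ (X X₁ X₂ D D₁ : ℝ → ℝ → ℝ) (C : ℝ), 0 ≤ C ∧ FamilyDeriv X X₁ ∧ FamilyDeriv X₁ X₂ ∧
      FamilyDeriv D D₁ ∧ (∀ μ, 0 < μ → ContinuousOn (X₂ μ) (Ici 0)) ∧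
      (∀ μ, 0 < μ → ContinuousOn (D₁ μ) (Ici 0)) ∧
      ∀ μ t, 0 < μ → 0 ≤ t → 1 ≤ μ * Ξ t →
        |X μ t - (a t)⁻¹| * (μ * Ξ t) ≤ C ∧ |X₁ μ t| * Ξ t ≤ C ∧ |D μ t - 1| * (μ * Ξ t) ≤ C ∧
        |D μ t - wkbForm a X X₁ X₂ μ t| * (μ ^ m * Ξ t ^ m) ≤ C ∧
        |D₁ μ t| * (μ ^ (m - 1) * Ξ t ^ m) ≤ C := by
  -- Corrections consume derivatives in pairs, so the parity of `m` matters. For even `m` the choice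
  -- `D = 1` leaves a defect of order exactly `m`. For odd `m` one derivative is left over: taking
  -- `D` to be the WKB form itself removes the defect, and the error moves to `D'`, which has the
  -- size `μ^{-(m-1)} Ξ^{-m}`.
  obtain ⟨L, r, hr, rfl⟩ : ∃ L r, r ≤ 1 ∧ m = r + 2 * L + 2 :=
    ⟨(m - 2) / 2, (m - 2) % 2, by omega, by omega⟩
  obtain ⟨X, X₁, X₂, hX, hX₁, h0, h1, h2, hK⟩ := exists_wkb ha₀ ha hΞ L r h
  obtain ⟨C₀, hC₀, b0⟩ := (IsSymbol.lower (p := 1) (q := 1) hΞ 1 h0).bound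
  obtain ⟨C₁, hC₁, b1⟩ := h1.bound
  obtain ⟨C₂, hC₂, b2⟩ := hK.bound
  obtain ⟨C₃, hC₃, b3⟩ := (IsSymbol.lower (p := 1) (q := 1) hΞ (2 * L + 1)
    (show IsSymbol Ξ r (1 + (2 * L + 1)) (1 + (2 * L + 1)) _ by convert! hK using 1 <;> ring)).bound
  have hx2 : ∀ μ, 0 < μ → ContinuousOn (X₂ μ) (Ici 0) := fun μ hμ => h2.continuousOn hμ
  interval_cases r
  · refine ⟨X, X₁, X₂, fun _ _ => 1, fun _ _ => 0, C₀ + C₁ + C₂, by positivity, hX, hX₁,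
      fun μ t _ _ => hasDerivWithinAt_const _ _ _, hx2, fun _ _ => continuousOn_const,
      fun μ t hμ ht hz => ⟨?_, ?_, ?_, ?_, ?_⟩⟩
    · have := b0 μ t hμ ht hz
      rw [pow_one, pow_one] at this; linarith
    · have := b1 μ t hμ ht hz
      rw [pow_zero, one_mul, pow_one] at this; linarith
    · simp only [sub_self, abs_zero, zero_mul]; positivity
    · have := b2 μ t hμ ht hz
      rw [show 0 + 2 * L + 2 = 2 * L + 2 by ring]; linarith
    · simp only [abs_zero, zero_mul]; positivity
  · obtain ⟨D₁, hD₁, hs⟩ := hK.2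
    obtain ⟨C₄, hC₄, b4⟩ := hs.bound
    refine ⟨X, X₁, X₂, wkbForm a X X₁ X₂, fun μ t => -D₁ μ t, C₀ + C₁ + C₃ + C₄, by positivity,
      hX, hX₁, fun μ t hμ ht => ?_, hx2, fun μ hμ => (hs.continuousOn hμ).neg,
      fun μ t hμ ht hz => ⟨?_, ?_, ?_, ?_, ?_⟩⟩
    · have := (hD₁ μ t hμ ht).const_sub 1
      simpa using this
    · have := b0 μ t hμ ht hz
      rw [pow_one, pow_one] at this; linarith
    · have := b1 μ t hμ ht hz
      rw [pow_zero, one_mul, pow_one] at this; linarith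
    · have := b3 μ t hμ ht hz
      rw [pow_one, pow_one, abs_sub_comm] at this; linarith
    · simp only [sub_self, abs_zero, zero_mul]; positivity
    · have := b4 μ t hμ ht hz
      rw [abs_neg, show 1 + 2 * L + 2 = 2 * L + 2 + 1 by ring, Nat.add_sub_cancel]; linarith

/-- Bound for the rate of change of the quadratic form with coefficients `x`, `-x' / (2μ)` and
`(D + y²) / x`. -/
theorem wkb_rate_bound {μ A x x' x'' D D' C β a₁ : ℝ} (hμ : 0 < μ) (hx : 0 < x)
    (hinv : 1 / x ≤ 2 * a₁) (ha₁ : 0 < a₁) (hC : 0 ≤ C) (hβ : 0 < β) (hyr : |-x' / (2 * μ)| ≤ 1)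
    (b4 : μ * |D - (A ^ 2 * x ^ 2 + x * x'' / (2 * μ ^ 2) - x' ^ 2 / (4 * μ ^ 2))| ≤ C * β)
    (b5 : |D'| ≤ C * β) (V Z : ℝ) :
    |(x' + 2 * μ * (-x' / (2 * μ))) * V ^ 2 + 2 * (-x'' / (2 * μ) - A ^ 2 * μ * x +
      μ * ((D + (-x' / (2 * μ)) ^ 2) / x)) * (V * Z) +
      (((D' + 2 * (-x' / (2 * μ)) * (-x'' / (2 * μ))) * x -
        (D + (-x' / (2 * μ)) ^ 2) * x') / x ^ 2 - 2 * μ * A ^ 2 * (-x' / (2 * μ))) * Z ^ 2| ≤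
      (2 * a₁ * C + 2 * a₁ * (C + 4 * a₁ * C)) * β * (V ^ 2 + Z ^ 2) := by
  obtain ⟨y, hy⟩ : ∃ y, y = -x' / (2 * μ) := ⟨_, rfl⟩
  obtain ⟨y', hy'⟩ : ∃ y', y' = -x'' / (2 * μ) := ⟨_, rfl⟩
  have hxy : x' = -(2 * μ * y) := by rw [hy]; field_simp
  have hxy' : x'' = -(2 * μ * y') := by rw [hy']; field_simp
  rw [← hy] at hyr
  rw [← hy, ← hy']
  have e0 : A ^ 2 * x ^ 2 + x * x'' / (2 * μ ^ 2) - x' ^ 2 / (4 * μ ^ 2) =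
      A ^ 2 * x ^ 2 - x * y' / μ - y ^ 2 := by
    rw [hxy, hxy']; field_simp; ring
  rw [e0] at b4
  -- The choice `y = -x'/(2μ)` kills the coefficient of `V²`. Half the coefficient of `VZ` is then
  -- `c₂`, which equals `μ/x` times the WKB defect, and the coefficient of `Z²` collapses to `(D' +
  -- 2 y c₂)/x`.
  obtain ⟨c₂, hc₂⟩ : ∃ c₂, c₂ = y' - A ^ 2 * μ * x + μ * ((D + y ^ 2) / x) := ⟨_, rfl⟩
  have e2 : c₂ = μ * (D - (A ^ 2 * x ^ 2 - x * y' / μ - y ^ 2)) / x := by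
    rw [hc₂]
    field_simp
    ring
  obtain ⟨c₃, hc₃⟩ : ∃ c₃, c₃ = (D' + 2 * y * c₂) / x := ⟨_, rfl⟩
  have e3 : ((D' + 2 * y * y') * x - (D + y ^ 2) * x') / x ^ 2 - 2 * μ * A ^ 2 * y = c₃ := by
    rw [hc₃, hc₂, hxy]
    field_simp
    ring
  have hc₂b : |c₂| ≤ 2 * a₁ * C * β := by
    rw [e2, abs_div, abs_mul, abs_of_pos hμ, abs_of_pos hx, div_eq_mul_one_div]
    calc _ ≤ C * β * (2 * a₁) := by gcongr
      _ = _ := by ring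
  have hc₃b : |c₃| ≤ 2 * a₁ * (C + 4 * a₁ * C) * β := by
    rw [hc₃, abs_div, abs_of_pos hx, div_eq_mul_one_div]
    have h3 : |D' + 2 * y * c₂| ≤ C * β + 2 * (2 * a₁ * C * β) := by
      refine (abs_add_le _ _).trans (add_le_add b5 ?_)
      rw [abs_mul, abs_mul, abs_two]
      calc 2 * |y| * |c₂| ≤ 2 * 1 * (2 * a₁ * C * β) := by gcongr
        _ = _ := by ring
    calc _ ≤ (C * β + 2 * (2 * a₁ * C * β)) * (2 * a₁) := by gcongr
      _ = _ := by ring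
  have h1 : |2 * (V * Z)| ≤ V ^ 2 + Z ^ 2 := by
    rw [abs_le]; constructor <;> nlinarith [sq_nonneg (V - Z), sq_nonneg (V + Z)]
  have e1 : x' + 2 * μ * y = 0 := by rw [hxy]; ring
  rw [e1, e3, ← hc₂]
  have e4 : 0 * V ^ 2 + 2 * c₂ * (V * Z) + c₃ * Z ^ 2 = c₂ * (2 * (V * Z)) + c₃ * Z ^ 2 := by ring
  rw [e4]
  calc _ ≤ |c₂| * |2 * (V * Z)| + |c₃| * Z ^ 2 := by
        refine (abs_add_le _ _).trans (le_of_eq ?_)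
        rw [abs_mul, abs_mul c₃, abs_of_nonneg (sq_nonneg Z)]
    _ ≤ 2 * a₁ * C * β * (V ^ 2 + Z ^ 2) +
        2 * a₁ * (C + 4 * a₁ * C) * β * (V ^ 2 + Z ^ 2) := by
        gcongr
        nlinarith [sq_nonneg V]
    _ = _ := by ring

/-- The energy estimate in the hyperbolic zone. -/
theorem exists_comparable_hyperbolic {a Ξ : ℝ → ℝ} {a₀ a₁ : ℝ} (ha₀ : 0 < a₀)
    (ha : ∀ t, 0 ≤ t → a₀ ≤ a t ∧ a t ≤ a₁) (hΞ : ∀ t, 0 ≤ t → 0 < Ξ t) {m : ℕ} (hm : 2 ≤ m)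
    (h : IsSymbol Ξ m 0 0 (fun _ => a)) (hint : IntegrableOn (fun s => ((Ξ s) ^ m)⁻¹) (Ici 0))
    (S : ℝ) (hS : 0 ≤ S) :
    ∃ N K : ℝ, 0 < N ∧ 1 ≤ K ∧ ∀ (N' : ℝ), N ≤ N' → ∀ (μ T : ℝ) (g v z : ℝ → ℝ), 0 < μ →
      IsMode a μ T g v z → ∀ s, 0 ≤ s → s ≤ T → (∀ r ∈ Icc s T, N' ≤ μ * Ξ r) →
      (μ ^ (m - 1))⁻¹ * (∫ r in s..T, ((Ξ r) ^ m)⁻¹) ≤ S → ModeComparable K g v z s T := by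
  obtain ⟨X, X₁, X₂, D, D₁, C, hC, hX, hX₁, hD, hX₂c, hD₁c, hb⟩ :=
    exists_wkb_of_order ha₀ (fun t ht => (ha t ht).1) hΞ hm h
  have ha₁ : 0 < a₁ := by have := ha 0 le_rfl; linarith
  set x₀ := 1 / (2 * a₁) with hx₀
  set x₁ := 2 / a₀ with hx₁
  set c := (2 * x₁ + 2 / x₀ + 4 * x₁ / x₀ ^ 2)⁻¹ with hc
  set Q := x₁ + 1 + 3 / x₀ with hQ
  set κ := 2 * a₁ * C + 2 * a₁ * (C + 4 * a₁ * C) with hκ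
  have hx₀p : 0 < x₀ := by positivity
  have hx₁p : 0 < x₁ := by positivity
  have hcp : 0 < c := by positivity
  have hκ0 : 0 ≤ κ := by positivity
  have hcQ : c ≤ Q := by
    have h01 : x₀ ≤ x₁ := by
      rw [hx₀, hx₁, div_le_div_iff₀ (by positivity) ha₀]
      have := ha 0 le_rfl; linarith
    have hf := form_bounds (x := x₀) (y := 0) (D := 1) hx₀p le_rfl h01 (by simp) (by norm_num)
      (by norm_num) 1 0
    have := hf.1.trans hf.2
    simpa using this
  -- Where `μ Ξ ≥ C (2 a₁ + 2)`, the quantities `|X - 1/a|` and `|D - 1|` are at most `1/(2 a₁ +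
  -- 2)`. This is below `x₀ = 1/(2 a₁)` and below `1/2`, so `X` lies in `[x₀, x₁]` and `D` in `[1/2,
  -- 2]`. The same threshold gives `|X'|/(2μ) ≤ 1`.
  refine ⟨max 1 (C * (2 * a₁ + 2)), 4 * Q / c * Real.exp (κ * S / c), by positivity,
    one_le_comparison_constant hcp hcQ (by positivity),
    fun N' hN' μ T g v z hμ hmode s hs hsT hzone hSint => ?_⟩
  have hsub : Icc s T ⊆ Ici 0 := fun r hr => hs.trans hr.1
  have zone : ∀ r ∈ Icc s T, 0 ≤ r ∧ 1 ≤ μ * Ξ r ∧ C * (2 * a₁ + 2) ≤ μ * Ξ r := fun r hr =>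
    ⟨hsub hr, (le_max_left _ _).trans (hN'.trans (hzone r hr)),
      (le_max_right _ _).trans (hN'.trans (hzone r hr))⟩
  have hsmall : ∀ r ∈ Icc s T, ∀ A : ℝ, |A| * (μ * Ξ r) ≤ C → |A| ≤ 1 / (2 * a₁ + 2) := by
    intro r hr A hA
    obtain ⟨-, h1, h2⟩ := zone r hr
    rw [le_div_iff₀ (by positivity)]
    by_contra! hcon
    have h3 : 0 < μ * Ξ r := by linarith
    nlinarith [mul_lt_mul_of_pos_right hcon h3]
  have hXb : ∀ r ∈ Icc s T, x₀ ≤ X μ r ∧ X μ r ≤ x₁ := by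
    intro r hr
    obtain ⟨h0, h1, h2⟩ := zone r hr
    have har := ha r h0
    have harp : 0 < a r := ha₀.trans_le har.1
    have h3 := abs_le.1 (hsmall r hr _ (hb μ r hμ h0 h1).1)
    have h4 : 1 / (2 * a₁ + 2) ≤ x₀ := by rw [hx₀]; gcongr; linarith
    have h5 : a₁⁻¹ ≤ (a r)⁻¹ := inv_anti₀ harp har.2
    have h6 : (a r)⁻¹ ≤ a₀⁻¹ := inv_anti₀ ha₀ har.1
    have h7 : a₁⁻¹ = 2 * x₀ := by rw [hx₀]; field_simp
    have h8 : x₁ = 2 * a₀⁻¹ := by rw [hx₁]; ring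
    constructor <;> linarith
  have hYb : ∀ r ∈ Icc s T, |-(X₁ μ r) / (2 * μ)| ≤ 1 := by
    intro r hr
    obtain ⟨h0, h1, h2⟩ := zone r hr
    have h3 := (hb μ r hμ h0 h1).2.1
    have h4 := hΞ r h0
    rw [abs_div, abs_neg, abs_of_pos (show 0 < 2 * μ by linarith), div_le_one (by positivity)]
    by_contra! hcon
    nlinarith [mul_lt_mul_of_pos_right hcon h4]
  have hDb : ∀ r ∈ Icc s T, 1 / 2 ≤ D μ r ∧ D μ r ≤ 2 := by
    intro r hr
    obtain ⟨h0, h1, h2⟩ := zone r hr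
    have h3 := abs_le.1 (hsmall r hr _ (hb μ r hμ h0 h1).2.2.1)
    have h4 : 1 / (2 * a₁ + 2) ≤ 1 / 2 := by gcongr; linarith
    constructor <;> linarith
  have hXd : ∀ r ∈ Icc s T, HasDerivWithinAt (X μ) (X₁ μ r) (Icc s T) r := fun r hr =>
    (hX μ r hμ (hsub hr)).mono hsub
  have hYd : ∀ r ∈ Icc s T, HasDerivWithinAt (fun r => -(X₁ μ r) / (2 * μ))
      (-(X₂ μ r) / (2 * μ)) (Icc s T) r := fun r hr =>
    (((hX₁ μ r hμ (hsub hr)).mono hsub).neg).div_const _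
  have hDd : ∀ r ∈ Icc s T, HasDerivWithinAt (D μ) (D₁ μ r) (Icc s T) r := fun r hr =>
    (hD μ r hμ (hsub hr)).mono hsub
  have hWd : ∀ r ∈ Icc s T, HasDerivWithinAt
      (fun r => (D μ r + (-(X₁ μ r) / (2 * μ)) ^ 2) / X μ r)
      (((D₁ μ r + 2 * (-(X₁ μ r) / (2 * μ)) * (-(X₂ μ r) / (2 * μ))) * X μ r -
        (D μ r + (-(X₁ μ r) / (2 * μ)) ^ 2) * X₁ μ r) / X μ r ^ 2) (Icc s T) r := by
    intro r hr
    have := ((hDd r hr).fun_add ((hYd r hr).fun_pow 2)).fun_div (hXd r hr)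
      (hx₀p.trans_le (hXb r hr).1).ne'
    simpa using this
  have cX := (hX.continuousOn hμ).mono hsub
  have cX₁ := (hX₁.continuousOn hμ).mono hsub
  have cX₂ := (hX₂c μ hμ).mono hsub
  have cD := (hD.continuousOn hμ).mono hsub
  have cD₁ := (hD₁c μ hμ).mono hsub
  have cY : ContinuousOn (fun r => -(X₁ μ r) / (2 * μ)) (Icc s T) := cX₁.neg.div_const _
  have cY' : ContinuousOn (fun r => -(X₂ μ r) / (2 * μ)) (Icc s T) := cX₂.neg.div_const _
  have hIi := intervalIntegrable_of_integrableOn_Ici hint hs hsT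
  have key := hmode.comparable_of_quadratic (b := fun r => κ * ((μ ^ (m - 1))⁻¹ * (Ξ r ^ m)⁻¹))
    (C := Q) hs hsT le_rfl hcp hXd hYd hWd cX₁ cY'
    ((((cD₁.add ((continuousOn_const.mul cY).mul cY')).mul cX).sub
      ((cD.add (cY.pow 2)).mul cX₁)).div (cX.pow 2) fun r hr =>
        (pow_pos (hx₀p.trans_le (hXb r hr).1) 2).ne')
    (fun r hr V Z => (form_bounds hx₀p (hXb r hr).1 (hXb r hr).2 (hYb r hr) (hDb r hr).1
      (hDb r hr).2 V Z).1)
    (fun r hr V Z => (form_bounds hx₀p (hXb r hr).1 (hXb r hr).2 (hYb r hr) (hDb r hr).1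
      (hDb r hr).2 V Z).2)
    ((hIi.const_mul _).const_mul _)
    (fun r hr => by have := hΞ r (hsub hr); positivity)
    (fun r hr V Z => by
      obtain ⟨h0, h1, h2⟩ := zone r hr
      obtain ⟨-, -, -, b4, b5⟩ := hb μ r hμ h0 h1
      have hXr := hXb r hr
      have hXp : 0 < X μ r := hx₀p.trans_le hXr.1
      have hyr := hYb r hr
      have hΞr := hΞ r h0
      set β := (μ ^ (m - 1))⁻¹ * (Ξ r ^ m)⁻¹ with hβ
      have hβ0 : 0 < β := by positivity
      have hinv : 1 / X μ r ≤ 2 * a₁ := by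
        rw [div_le_iff₀ hXp]
        have : 2 * a₁ * x₀ = 1 := by rw [hx₀]; field_simp
        nlinarith [hXr.1]
      have hm1 : μ ^ m = μ * μ ^ (m - 1) := by
        rw [← pow_succ']; congr 1; omega
      have b4' : μ * |D μ r - wkbForm a X X₁ X₂ μ r| ≤ C * β := by
        rw [hβ, ← mul_inv, ← div_eq_mul_inv, le_div_iff₀ (by positivity)]
        rw [hm1] at b4
        linarith
      have b5' : |D₁ μ r| ≤ C * β := by
        rw [hβ, ← mul_inv, ← div_eq_mul_inv, le_div_iff₀ (by positivity)]
        exact b5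
      exact wkb_rate_bound hμ hXp hinv ha₁ hC hβ0 hyr b4' b5' V Z)
  refine key.mono ?_ hsT
  rw [intervalIntegral.integral_const_mul, intervalIntegral.integral_const_mul]
  gcongr

/-- The time axis is cut at `s` with `μ ∫₀ˢ |a - a∞| = P`. Before `s` the stabilised estimate
applies with `N = P`. After `s`, from `P ≤ μ Θ(s)`, monotonicity of `Θ` and (H3*) one is in the
hyperbolic zone. If the level `P` is not passed before `T`, the first estimate suffices. -/
theorem exists_modeBound_of_tailBound {a Θ Ξ : ℝ → ℝ} {a₀ a₁ : ℝ}
    (ha_meas : AEMeasurable a (volume.restrict (Ici 0))) (ha₀ : 0 < a₀)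
    (ha : ∀ t, 0 ≤ t → a₀ ≤ a t ∧ a t ≤ a₁) {m : ℕ} (hΘ : PosMono Θ) (hΞ : PosMono Ξ)
    (hstab : Stabilizes a Θ) (hd : DerivBounds m a Ξ) (hdom : Dominated Θ Ξ)
    (htail : TailBound m Θ Ξ) (M : ℝ) : ∃ K, ModeBound a M K := by
  obtain ⟨aInf, hInf, hst⟩ := hstab
  obtain ⟨C₀, hC₀, hdom⟩ := hdom
  obtain ⟨hm, hint, S, hS⟩ := htail
  obtain ⟨-, hcd, hder⟩ := hd
  have ha₁ : 0 < a₁ := by have := ha 0 le_rfl; linarith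
  have hsym : IsSymbol Ξ m 0 0 (fun _ => a) := by
    refine isSymbol_of_contDiffOn hΞ.1 hcd fun j hj => ?_
    rcases Nat.eq_zero_or_pos j with rfl | hj0
    · refine ⟨a₁, fun t ht => ?_⟩
      have := ha t ht
      simp only [iteratedDerivWithin_zero, add_zero, pow_zero, inv_one, mul_one]
      rw [abs_of_pos (by linarith)]; exact this.2
    · obtain ⟨C, _, hC⟩ := hder j hj0 hj
      exact ⟨C, by simpa using hC⟩
  have hS' : ∀ t, 0 ≤ t → Θ t ^ (m - 1) * ∫ s in Ioi t, ((Ξ s) ^ m)⁻¹ ≤ S := fun t ht =>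
    hS (mem_image_of_mem _ ht)
  have htail0 : ∀ t, 0 ≤ t → 0 ≤ ∫ s in Ioi t, ((Ξ s) ^ m)⁻¹ := fun t ht =>
    setIntegral_nonneg measurableSet_Ioi fun r hr => by
      have := hΞ.1 r (ht.trans (le_of_lt hr)); positivity
  have hS0 : 0 ≤ S := by
    refine le_trans ?_ (hS' 0 le_rfl)
    have := hΘ.1 0 le_rfl
    exact mul_nonneg (by positivity) (htail0 0 le_rfl)
  obtain ⟨N₁, K₁, hN₁, hK₁, H⟩ := exists_comparable_hyperbolic ha₀ ha hΞ.1 hm hsym hint S hS0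
  set N := max N₁ 1 with hN
  have hN1 : 1 ≤ N := le_max_right _ _
  have hN0 : 0 < N := by linarith
  -- The part `C₀ N` ensures `μ Ξ ≥ N` after the cut. The part `1` ensures `1/μ ≤ Θ(s)`, which turns
  -- `μ^{-(m-1)} ∫ Ξ^{-m}` into the quantity bounded in (H4*), and it excludes `μ = 0`.
  set P := max (C₀ * N) 1 with hP
  have hP1 : 1 ≤ P := le_max_right _ _
  have hK0 := one_le_stabConst hInf ha₁.le (show 0 ≤ P by linarith)
  refine ⟨stabConst a₁ aInf P * K₁, by nlinarith, fun μ T hμ _ hT g v z hmode => ?_⟩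
  set I : ℝ → ℝ := fun t => ∫ r in (0 : ℝ)..t, |a r - aInf| with hI
  rcases le_total (μ * I T) P with hle | hge
  · exact (hmode.comparable_of_stabilization ha_meas ha₀ ha hμ hInf hT le_rfl hle).mono
      (le_mul_of_one_le_right (by linarith) hK₁) hT
  · have hIint := intervalIntegrable_abs_sub ha_meas ha₀ ha aInf le_rfl hT
    have hIc : ContinuousOn (fun t => μ * I t) (Icc 0 T) := by
      have := (hIint.absolutelyContinuousOnInterval_intervalIntegral
        (c := 0) left_mem_uIcc).continuousOn
      rw [uIcc_of_le hT] at this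
      exact continuousOn_const.mul this
    have hI0 : I 0 = 0 := by simp [hI]
    obtain ⟨s, ⟨hs0, hsT⟩, hsP⟩ := intermediate_value_Icc hT hIc
      ⟨by simp only [hI0, mul_zero]; linarith, hge⟩
    simp only at hsP
    have hμ0 : 0 < μ := by
      rcases hμ.eq_or_lt with h | h
      · rw [← h] at hsP; linarith
      · exact h
    have hIΘ : I s ≤ Θ s := hst s hs0
    have hΘs : P ≤ μ * Θ s := by rw [← hsP]; gcongr
    have h1 := hmode.comparable_of_stabilization ha_meas ha₀ ha hμ hInf hs0 hsT hsP.le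
    have h2 := H N (le_max_left _ _) μ T g v z hμ0 hmode s hs0 hsT (fun r hr => by
      have hr0 : 0 ≤ r := hs0.trans hr.1
      have e1 : Θ s ≤ Θ r := hΘ.2 hs0 hr0 hr.1
      have e2 := hdom r hr0
      have e3 : C₀ * N ≤ μ * (C₀ * Ξ r) := (le_max_left _ _).trans
        (hΘs.trans (mul_le_mul_of_nonneg_left (e1.trans e2) hμ))
      have e4 : C₀ * N ≤ C₀ * (μ * Ξ r) := by linarith
      exact le_of_mul_le_mul_left e4 hC₀) (by
      have e1 : ∫ r in s..T, ((Ξ r) ^ m)⁻¹ ≤ ∫ r in Ioi s, ((Ξ r) ^ m)⁻¹ := by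
        rw [intervalIntegral.integral_of_le hsT]
        refine setIntegral_mono_set (hint.mono_set fun r hr => hs0.trans (le_of_lt hr)) ?_
          Ioc_subset_Ioi_self.eventuallyLE
        rw [Filter.EventuallyLE, ae_restrict_iff' measurableSet_Ioi]
        exact Filter.Eventually.of_forall fun r hr => by
          have := hΞ.1 r (hs0.trans (le_of_lt hr)); simp only [Pi.zero_apply]; positivity
      have e2 : (μ ^ (m - 1))⁻¹ ≤ Θ s ^ (m - 1) := by
        rw [← inv_pow]
        gcongr
        rw [inv_le_iff_one_le_mul₀ hμ0]
        linarith
      calc _ ≤ Θ s ^ (m - 1) * ∫ r in Ioi s, ((Ξ r) ^ m)⁻¹ := by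
            exact (mul_le_mul_of_nonneg_left e1 (by positivity)).trans
              (mul_le_mul_of_nonneg_right e2 (htail0 s hs0))
        _ ≤ S := hS' s hs0)
    exact hmode.comparable_trans le_rfl hs0 hsT le_rfl hK0 hK₁ h1 h2


/-! ### Local boundedness by Baire category -/

theorem bddAbove_image_of_locally {n : ℝ → ℝ} {S : Set ℝ} (hS : IsCompact S)
    (h : ∀ t ∈ S, ∃ δ > 0, ∃ B, ∀ s ∈ S, |s - t| < δ → n s ≤ B) : BddAbove (n '' S) := by
  suffices H : ∃ B, ∀ s ∈ S, n s ≤ B by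
    obtain ⟨B, hB⟩ := H
    exact ⟨B, by rintro _ ⟨s, hs, rfl⟩; exact hB s hs⟩
  refine hS.induction_on (p := fun A => ∃ B, ∀ s ∈ A, n s ≤ B) ⟨0, by simp⟩ ?_ ?_ ?_
  · rintro A A' hAA ⟨B, hB⟩
    exact ⟨B, fun s hs => hB s (hAA hs)⟩
  · rintro A A' ⟨B, hB⟩ ⟨B', hB'⟩
    refine ⟨max B B', fun s hs => hs.elim (fun h => (hB s h).trans (le_max_left _ _))
      fun h => (hB' s h).trans (le_max_right _ _)⟩
  · intro t ht
    obtain ⟨δ, hδ, B, hB⟩ := h t ht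
    refine ⟨S ∩ Metric.ball t δ, Filter.inter_mem self_mem_nhdsWithin
      (mem_nhdsWithin_of_mem_nhds (Metric.ball_mem_nhds t hδ)), B, fun s hs => ?_⟩
    exact hB s hs.1 (by simpa [Real.dist_eq] using hs.2)

/-- A function with closed sublevel sets whose values are comparable on short intervals of
boundedness is bounded. -/
theorem exists_bound_of_comparable {n : ℝ → ℝ} {T ℓ K : ℝ} (hℓ : 0 < ℓ) (hK : 1 ≤ K)
    (hclosed : ∀ N : ℝ, IsClosed {t | t ∈ Icc 0 T ∧ n t ≤ N})
    (hcomp : ∀ α β, 0 ≤ α → α ≤ β → β ≤ T → β - α ≤ ℓ → BddAbove (n '' Icc α β) →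
      ∀ s ∈ Icc α β, ∀ t ∈ Icc α β, n s ≤ K * n t) :
    ∃ B, ∀ t ∈ Icc 0 T, n t ≤ B := by
  set G : Set ℝ := {t | ∃ δ > 0, ∃ B, ∀ s ∈ Icc 0 T, |s - t| < δ → n s ≤ B} with hG
  have hGopen : IsOpen G := by
    rw [Metric.isOpen_iff]
    rintro t ⟨δ, hδ, B, hB⟩
    refine ⟨δ / 2, by positivity, fun t' ht' => ⟨δ / 2, by positivity, B, fun s hs hst => ?_⟩⟩
    rw [Metric.mem_ball, Real.dist_eq] at ht'
    refine hB s hs ?_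
    have := abs_sub_le s t' t
    linarith
  have hloc : ∀ S : Set ℝ, IsCompact S → S ⊆ Icc 0 T → S ⊆ G → BddAbove (n '' S) := by
    intro S hS hST hSG
    refine bddAbove_image_of_locally hS fun t ht => ?_
    obtain ⟨δ, hδ, B, hB⟩ := hSG ht
    exact ⟨δ, hδ, B, fun s hs hst => hB s (hST hs) hst⟩
  by_cases hsub : Icc 0 T ⊆ G
  · obtain ⟨B, hB⟩ := hloc _ isCompact_Icc le_rfl hsub
    exact ⟨B, fun t ht => hB (mem_image_of_mem n ht)⟩
  exfalso
  obtain ⟨t₀, ht₀, ht₀G⟩ := not_subset.1 hsub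
  set F : Set ℝ := Icc 0 T \ G with hF
  have hFclosed : IsClosed F := isClosed_Icc.sdiff hGopen
  have : Nonempty F := ⟨⟨t₀, ht₀, ht₀G⟩⟩
  have : CompleteSpace F := hFclosed.completeSpace_coe
  -- `F` is the closed set of times near which `n` is unbounded. It is covered by the closed
  -- sublevel sets of `n`, so by Baire one of them contains a relative neighbourhood of some `x ∈
  -- F`. The rest of the proof bounds `n` near `x` also off `F`, contradicting `x ∈ F`.
  obtain ⟨N, hN⟩ := nonempty_interior_of_iUnion_of_closed (X := F) (ι := ℕ)
    (f := fun N => {x | n x ≤ N}) (fun N => by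
      have := (hclosed N).preimage (continuous_subtype_val (p := fun x => x ∈ F))
      convert! this using 1
      ext x
      simp only [mem_ofPred_eq, mem_preimage]
      exact ⟨fun h => ⟨x.2.1, h⟩, fun h => h.2⟩) (by
      ext x
      simpa using exists_nat_ge (n x))
  obtain ⟨x, hx⟩ := hN
  rw [mem_interior_iff_mem_nhds, Metric.mem_nhds_iff] at hx
  obtain ⟨δ, hδ, hball⟩ := hx
  have hFN : ∀ y ∈ F, |y - x| < δ → n y ≤ N := fun y hy hyx =>
    hball (show (⟨y, hy⟩ : F) ∈ Metric.ball x δ by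
      rw [Metric.mem_ball, Subtype.dist_eq, Real.dist_eq]; exact hyx)
  have hN0 : (0 : ℝ) ≤ N := Nat.cast_nonneg N
  refine x.2.2 ⟨min δ ℓ, lt_min hδ hℓ, K * N, fun t ht htx => ?_⟩
  have htδ := htx.trans_le (min_le_left _ _)
  have htℓ := htx.trans_le (min_le_right _ _)
  by_cases htF : t ∈ F
  · exact (hFN t htF htδ).trans (le_mul_of_one_le_left hN0 hK)
  have hx0 := x.2.1
  rcases le_total (x : ℝ) t with hxt | hxt
  · rw [abs_of_nonneg (sub_nonneg.2 hxt)] at htδ htℓ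
    have hc : IsCompact (F ∩ Icc x t) := isCompact_Icc.inter_left hFclosed
    have hne : (F ∩ Icc (x : ℝ) t).Nonempty := ⟨x, x.2, le_rfl, hxt⟩
    have hα := hc.sSup_mem hne
    -- `α` is the point of `F` nearest to `t` on the side of `x`. Compact intervals inside `(α, t]`
    -- avoid `F`, so comparability gives `n ≤ K n(t)` there. Thus `n` is bounded on all of `[α, t]`,
    -- and comparability applies once more to give `n(t) ≤ K n(α) ≤ K N`.
    set α := sSup (F ∩ Icc (x : ℝ) t) with hαdef
    have hαN : n α ≤ N := hFN α hα.1 (by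
      rw [abs_of_nonneg (sub_nonneg.2 hα.2.1)]; linarith [hα.2.2])
    have hαt : α < t := lt_of_le_of_ne hα.2.2 fun h => htF (h ▸ hα.1)
    have hGm : ∀ s, α < s → s ≤ t → s ∈ G := by
      intro s hs hst
      by_contra hsG
      have hmem : s ∈ F ∩ Icc (x : ℝ) t :=
        ⟨⟨⟨hx0.1.trans (hα.2.1.trans hs.le), hst.trans ht.2⟩, hsG⟩, hα.2.1.trans hs.le, hst⟩
      exact absurd (le_csSup hc.bddAbove hmem) (not_le.2 hs)
    have hbd : ∀ s ∈ Icc α t, n s ≤ max (n α) (K * n t) := by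
      intro s hs
      rcases hs.1.eq_or_lt with h | h
      · rw [← h]; exact le_max_left _ _
      · refine le_trans ?_ (le_max_right _ _)
        have hs0 : 0 ≤ s := hx0.1.trans (hα.2.1.trans h.le)
        exact hcomp s t hs0 hs.2 ht.2 (by linarith [hα.2.1])
          (hloc _ isCompact_Icc (Icc_subset_Icc hs0 ht.2) fun r hr =>
            hGm r (h.trans_le hr.1) hr.2) s ⟨le_rfl, hs.2⟩ t ⟨hs.2, le_rfl⟩
    refine (hcomp α t (hx0.1.trans hα.2.1) hαt.le ht.2 (by linarith [hα.2.1])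
      ⟨max (n α) (K * n t), ?_⟩ t ⟨hαt.le, le_rfl⟩ α ⟨le_rfl, hαt.le⟩).trans (by gcongr)
    rintro _ ⟨s, hs, rfl⟩; exact hbd s hs
  · rw [abs_sub_comm, abs_of_nonneg (sub_nonneg.2 hxt)] at htδ htℓ
    have hc : IsCompact (F ∩ Icc t x) := isCompact_Icc.inter_left hFclosed
    have hne : (F ∩ Icc t (x : ℝ)).Nonempty := ⟨x, x.2, hxt, le_rfl⟩
    have hα := hc.sInf_mem hne
    set α := sInf (F ∩ Icc t (x : ℝ)) with hαdef
    have hαN : n α ≤ N := hFN α hα.1 (by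
      rw [abs_sub_comm, abs_of_nonneg (sub_nonneg.2 hα.2.2)]; linarith [hα.2.1])
    have hαt : t < α := lt_of_le_of_ne hα.2.1 fun h => htF (h ▸ hα.1)
    have hGm : ∀ s, s < α → t ≤ s → s ∈ G := by
      intro s hs hst
      by_contra hsG
      have hmem : s ∈ F ∩ Icc t (x : ℝ) :=
        ⟨⟨⟨ht.1.trans hst, hs.le.trans (hα.2.2.trans hx0.2)⟩, hsG⟩, hst, hs.le.trans hα.2.2⟩
      exact absurd (csInf_le hc.bddBelow hmem) (not_le.2 hs)
    have hbd : ∀ s ∈ Icc t α, n s ≤ max (n α) (K * n t) := by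
      intro s hs
      rcases hs.2.eq_or_lt with h | h
      · rw [h]; exact le_max_left _ _
      · refine le_trans ?_ (le_max_right _ _)
        have hs0 : s ≤ T := h.le.trans (hα.2.2.trans hx0.2)
        exact hcomp t s ht.1 hs.1 hs0 (by linarith [hα.2.2])
          (hloc _ isCompact_Icc (Icc_subset_Icc ht.1 hs0) fun r hr =>
            hGm r (hr.2.trans_lt h) hr.1) s ⟨hs.1, le_rfl⟩ t ⟨le_rfl, hs.1⟩
    refine (hcomp t α ht.1 hαt.le (hα.2.2.trans hx0.2) (by linarith [hα.2.2])
      ⟨max (n α) (K * n t), ?_⟩ t ⟨le_rfl, hαt.le⟩ α ⟨hαt.le, le_rfl⟩).trans (by gcongr)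
    rintro _ ⟨s, hs, rfl⟩; exact hbd s hs

/-! ### Weak primitives in Hilbert spaces -/

section WeakPrimitive

variable {ι H : Type*} [NormedAddCommGroup H] [InnerProductSpace ℝ H]

/-- The inequality is closed in `φ`, hence holds for `φ = x`. -/
theorem norm_le_of_inner_le_of_dense {S : Submodule ℝ H} (hS : S.topologicalClosure = ⊤) {x : H}
    {c : ℝ} (hc : 0 ≤ c) (h : ∀ φ ∈ S, inner ℝ φ x ≤ ‖φ‖ * c) : ‖x‖ ≤ c := by
  have hcl : IsClosed {φ : H | inner ℝ φ x ≤ ‖φ‖ * c} :=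
    isClosed_le (by fun_prop) (by fun_prop)
  have hx : x ∈ closure (S : Set H) := by
    have : x ∈ S.topologicalClosure := by rw [hS]; trivial
    exact this
  have hsub : (S : Set H) ⊆ {φ : H | inner ℝ φ x ≤ ‖φ‖ * c} := fun φ hφ => h φ hφ
  have : inner ℝ x x ≤ ‖x‖ * c := closure_minimal hsub hcl hx
  rw [real_inner_self_eq_norm_sq, sq] at this
  rcases (norm_nonneg x).eq_or_lt with h0 | h0
  · rwa [← h0]
  · exact le_of_mul_le_mul_left this h0

/-- The coordinates of `f` in the Hilbert basis `b` are locally absolutely continuous on `[0, ∞)`,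
with the coordinates of `F` as almost everywhere derivatives. -/
structure IsWeakPrimitive (b : HilbertBasis ι ℝ H) (f F : ℝ → H) : Prop where
  ac : ∀ k T, 0 ≤ T → AbsolutelyContinuousOnInterval (fun t => inner ℝ (b k) (f t)) 0 T
  deriv : ∀ k, ∀ᵐ t : ℝ, 0 < t → HasDerivAt (fun s => inner ℝ (b k) (f s)) (inner ℝ (b k) (F t)) t

variable {b : HilbertBasis ι ℝ H} {f F : ℝ → H}

theorem IsWeakPrimitive.ac_span (h : IsWeakPrimitive b f F) {φ : H}
    (hφ : φ ∈ Submodule.span ℝ (range b)) {T : ℝ} (hT : 0 ≤ T) :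
    AbsolutelyContinuousOnInterval (fun t => inner ℝ φ (f t)) 0 T := by
  induction hφ using Submodule.span_induction with
  | mem x hx => obtain ⟨k, rfl⟩ := hx; exact h.ac k T hT
  | zero =>
    simp only [inner_zero_left]
    exact absolutelyContinuousOnInterval_of_hasDerivWithinAt hT
      (fun r _ => hasDerivWithinAt_const _ _ _) continuousOn_const
  | add x y _ _ hx hy => simpa only [inner_add_left] using hx.fun_add hy
  | smul c x _ hx => simpa only [real_inner_smul_left] using hx.const_mul c

theorem IsWeakPrimitive.deriv_span (h : IsWeakPrimitive b f F) {φ : H}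
    (hφ : φ ∈ Submodule.span ℝ (range b)) :
    ∀ᵐ t : ℝ, 0 < t → HasDerivAt (fun s => inner ℝ φ (f s)) (inner ℝ φ (F t)) t := by
  induction hφ using Submodule.span_induction with
  | mem x hx => obtain ⟨k, rfl⟩ := hx; exact h.deriv k
  | zero =>
    simp only [inner_zero_left]
    exact Filter.Eventually.of_forall fun t _ => hasDerivAt_const _ _
  | add x y _ _ hx hy =>
    filter_upwards [hx, hy] with t h1 h2 ht
    simpa only [inner_add_left] using (h1 ht).fun_add (h2 ht)
  | smul c x _ hx =>
    filter_upwards [hx] with t h1 ht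
    simpa only [real_inner_smul_left] using (h1 ht).const_mul c

/-- Testing against finite combinations of basis vectors reduces the bound to scalar absolutely
continuous functions. No measurability of `F` as a vector-valued map is needed, and the exceptional
null set may depend on the test vector. -/
theorem IsWeakPrimitive.norm_sub_le (h : IsWeakPrimitive b f F) {α β M : ℝ} (hα : 0 ≤ α)
    (hαβ : α ≤ β) (hM : 0 ≤ M) (hF : ∀ t ∈ Ioo α β, ‖F t‖ ≤ M) : ‖f β - f α‖ ≤ M * (β - α) := by
  refine norm_le_of_inner_le_of_dense b.dense_span (mul_nonneg hM (sub_nonneg.2 hαβ))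
    fun φ hφ => ?_
  have hac := (h.ac_span hφ (hα.trans hαβ)).mono (c := α) (d := β) (by
    rw [uIcc_of_le hαβ, uIcc_of_le (hα.trans hαβ)]; exact Icc_subset_Icc_left hα)
  have := sub_le_integral_of_ae_deriv_le (g := fun _ => ‖φ‖ * M) hαβ hac (by simp) (by
    filter_upwards [h.deriv_span hφ] with t ht htm
    refine ⟨_, ht (hα.trans_lt htm.1), (real_inner_le_norm _ _).trans ?_⟩
    exact mul_le_mul_of_nonneg_left (hF t htm) (norm_nonneg φ))
  rw [intervalIntegral.integral_const, smul_eq_mul] at this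
  rw [inner_sub_right]
  linarith

/-- Lower semicontinuity of the norm: the set is an intersection of closed conditions, one for each
test vector. It supplies the closed sublevel sets for the Baire argument. -/
theorem IsWeakPrimitive.isClosed_norm_le (h : IsWeakPrimitive b f F) {T : ℝ} (hT : 0 ≤ T)
    (N : ℝ) : IsClosed {t | t ∈ Icc 0 T ∧ ‖f t‖ ≤ N} := by
  rcases lt_or_ge N 0 with hN | hN
  · convert isClosed_empty (X := ℝ)
    ext t
    simp only [mem_ofPred_eq, mem_empty_iff_false, iff_false, not_and, not_le]
    exact fun _ => hN.trans_le (norm_nonneg _)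
  have e : {t | t ∈ Icc 0 T ∧ ‖f t‖ ≤ N} = Icc 0 T ∩ ⋂ φ ∈ Submodule.span ℝ (range b),
      (Icc 0 T ∩ (fun t => inner ℝ φ (f t)) ⁻¹' Iic (‖φ‖ * N)) := by
    ext t
    simp only [mem_ofPred_eq, mem_inter_iff, mem_iInter, mem_preimage, mem_Iic]
    refine ⟨fun ht => ⟨ht.1, fun φ _ => ⟨ht.1, ?_⟩⟩, fun ht => ⟨ht.1, ?_⟩⟩
    · exact (real_inner_le_norm _ _).trans (mul_le_mul_of_nonneg_left ht.2 (norm_nonneg φ))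
    · exact norm_le_of_inner_le_of_dense b.dense_span hN fun φ hφ => (ht.2 φ hφ).2
  rw [e]
  refine isClosed_Icc.inter (isClosed_biInter fun φ hφ => ?_)
  have := (h.ac_span hφ hT).continuousOn
  rw [uIcc_of_le hT] at this
  exact this.preimage_isClosed_of_isClosed isClosed_Icc isClosed_Iic

theorem IsWeakPrimitive.sub_smul (h : IsWeakPrimitive b f F) (x : H) :
    IsWeakPrimitive b (fun t => f t - t • x) (fun t => F t - x) where
  ac k T hT := by
    simp only [inner_sub_right, real_inner_smul_right]
    refine (h.ac k T hT).fun_sub (absolutelyContinuousOnInterval_of_hasDerivWithinAt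
      (f' := fun _ => inner ℝ (b k) x) hT (fun r _ => ?_) continuousOn_const)
    simpa using (hasDerivWithinAt_id r _).mul_const (inner ℝ (b k) x)
  deriv k := by
    filter_upwards [h.deriv k] with t ht h0
    simp only [inner_sub_right, real_inner_smul_right]
    refine (ht h0).fun_sub ?_
    simpa using (hasDerivAt_id t).mul_const (inner ℝ (b k) x)

/-- Subtracting the tangent `s • F t` leaves a weak primitive of `F - F t`, whose increments near
`t` are small by `norm_sub_le`. -/
theorem IsWeakPrimitive.hasDerivAt (h : IsWeakPrimitive b f F) {t : ℝ} (ht : 0 < t)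
    (hF : ContinuousAt F t) : HasDerivAt f (F t) t := by
  rw [hasDerivAt_iff_isLittleO, Asymptotics.isLittleO_iff]
  intro c hc
  obtain ⟨δ, hδ, hball⟩ := Metric.continuousAt_iff.1 hF c hc
  filter_upwards [Metric.ball_mem_nhds t hδ, Ioi_mem_nhds ht] with s hs hs0
  rw [mem_Ioi] at hs0
  rw [Metric.mem_ball, Real.dist_eq] at hs
  have hsub := h.sub_smul (F t)
  have hb : ∀ r, |r - t| < δ → ‖F r - F t‖ ≤ c := fun r hr => by
    rw [← dist_eq_norm]; exact (hball (by rwa [Real.dist_eq])).le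
  rcases le_total s t with hst | hst
  · have := hsub.norm_sub_le hs0.le hst hc.le fun r hr => hb r (by
      rw [abs_of_nonpos (by linarith)] at hs
      rw [abs_of_neg (by linarith [hr.2])]; linarith [hr.1])
    rw [Real.norm_eq_abs, abs_of_nonpos (by linarith), neg_sub, ← norm_neg]
    refine le_trans (le_of_eq ?_) this
    congr 1
    rw [_root_.sub_smul]; abel
  · have := hsub.norm_sub_le ht.le hst hc.le fun r hr => hb r (by
      rw [abs_of_nonneg (by linarith)] at hs
      rw [abs_of_pos (by linarith [hr.1])]; linarith [hr.2])
    rw [Real.norm_eq_abs, abs_of_nonneg (by linarith)]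
    refine le_trans (le_of_eq ?_) this
    congr 1
    rw [_root_.sub_smul]; abel

theorem IsWeakPrimitive.lipschitzOnWith (h : IsWeakPrimitive b f F) {T M : ℝ}
    (hM : 0 ≤ M) (hF : ∀ t ∈ Icc 0 T, ‖F t‖ ≤ M) : LipschitzOnWith M.toNNReal f (Icc 0 T) := by
  have key : ∀ s ∈ Icc 0 T, ∀ t ∈ Icc 0 T, s ≤ t → ‖f t - f s‖ ≤ M * (t - s) :=
    fun s hs t ht hst => h.norm_sub_le hs.1 hst hM fun r hr =>
      hF r ⟨hs.1.trans hr.1.le, hr.2.le.trans ht.2⟩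
  refine LipschitzOnWith.of_dist_le_mul fun s hs t ht => ?_
  rw [Real.coe_toNNReal _ hM, dist_eq_norm, Real.dist_eq]
  rcases le_total s t with hst | hst
  · rw [← norm_neg, neg_sub, abs_sub_comm, abs_of_nonneg (sub_nonneg.2 hst)]
    exact key s hs t ht hst
  · rw [abs_of_nonneg (sub_nonneg.2 hst)]
    exact key t ht s hs hst

end WeakPrimitive

/-! ### The abstract wave equation -/

section Wave

variable {ι₁ ι₂ H₁ H₂ : Type*} [NormedAddCommGroup H₁] [InnerProductSpace ℝ H₁] [CompleteSpace H₁]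
  [NormedAddCommGroup H₂] [InnerProductSpace ℝ H₂] [CompleteSpace H₂]

/-- Weak solutions of the system `v' = -a² D† w`, `w' = D v`. -/
structure IsWeakWave (b₁ : HilbertBasis ι₁ ℝ H₁) (b₂ : HilbertBasis ι₂ ℝ H₂) (a : ℝ → ℝ)
    (D : H₁ →L[ℝ] H₂) (v : ℝ → H₁) (w : ℝ → H₂) : Prop where
  left : IsWeakPrimitive b₁ v fun t => -(a t ^ 2) • D.adjoint (w t)
  right : IsWeakPrimitive b₂ w fun t => D (v t)

variable {b₁ : HilbertBasis ι₁ ℝ H₁} {b₂ : HilbertBasis ι₂ ℝ H₂} {a : ℝ → ℝ} {a₁ : ℝ}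
  {D : H₁ →L[ℝ] H₂} {v : ℝ → H₁} {w : ℝ → H₂}

theorem norm_rate_le (ha : ∀ t, 0 ≤ t → 0 ≤ a t ∧ a t ≤ a₁) {t B : ℝ} (ht : 0 ≤ t)
    (hw : ‖w t‖ ≤ B) : ‖-(a t ^ 2) • D.adjoint (w t)‖ ≤ a₁ ^ 2 * ‖D‖ * B := by
  have h := ha t ht
  rw [norm_smul, norm_neg, Real.norm_eq_abs, abs_of_nonneg (sq_nonneg _), mul_assoc]
  have h1 : ‖D.adjoint (w t)‖ ≤ ‖D‖ * B := by
    refine (D.adjoint.le_opNorm (w t)).trans ?_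
    rw [LinearIsometryEquiv.norm_map]
    gcongr
  have h2 : a t ^ 2 ≤ a₁ ^ 2 := by
    have := h.1
    gcongr
    exact h.2
  gcongr

/-- The rates of `v` and `w` are at most `L` times the supremum `B` of the norms. On an interval of
length `1/(2L)` on which `B` is finite, the norms therefore vary by at most `B/2`. Hence `B ≤ 2
n(t)` for every `t` in it, the comparability required by the Baire lemma with `K = 2`. -/
theorem IsWeakWave.exists_bound (h : IsWeakWave b₁ b₂ a D v w)
    (ha : ∀ t, 0 ≤ t → 0 ≤ a t ∧ a t ≤ a₁) {T : ℝ} (hT : 0 ≤ T) :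
    ∃ B, 0 ≤ B ∧ ∀ t ∈ Icc 0 T, ‖v t‖ ≤ B ∧ ‖w t‖ ≤ B := by
  set L : ℝ := (a₁ ^ 2 + 1) * (‖D‖ + 1) with hL
  have hL0 : 0 < L := by positivity
  obtain ⟨B, hB⟩ := exists_bound_of_comparable (n := fun t => max ‖v t‖ ‖w t‖) (T := T)
    (ℓ := 1 / (2 * L)) (K := 2) (by positivity) (by norm_num)
    (fun N => by
      have := (h.left.isClosed_norm_le hT N).inter (h.right.isClosed_norm_le hT N)
      convert! this using 1
      ext t
      simp only [mem_ofPred_eq, mem_inter_iff, max_le_iff]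
      tauto)
    (fun α β hα hαβ hβ hℓ hbdd s hs t ht => by
      obtain ⟨r₀, hr₀⟩ : ((fun t => max ‖v t‖ ‖w t‖) '' Icc α β).Nonempty :=
        ⟨_, mem_image_of_mem _ hs⟩
      set B := sSup ((fun t => max ‖v t‖ ‖w t‖) '' Icc α β) with hB
      have hle : ∀ r ∈ Icc α β, ‖v r‖ ≤ B ∧ ‖w r‖ ≤ B := fun r hr =>
        max_le_iff.1 (le_csSup hbdd (mem_image_of_mem (fun t => max ‖v t‖ ‖w t‖) hr))
      have hB0 : 0 ≤ B := (norm_nonneg _).trans (hle s hs).1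
      have step : ∀ r ∈ Icc α β, ∀ r' ∈ Icc α β, r ≤ r' →
          ‖v r' - v r‖ ≤ B / 2 ∧ ‖w r' - w r‖ ≤ B / 2 := by
        intro r hr r' hr' hrr'
        have hlen : L * B * (r' - r) ≤ B / 2 := by
          have h1 : r' - r ≤ 1 / (2 * L) := by linarith [hr.1, hr'.2]
          calc L * B * (r' - r) ≤ L * B * (1 / (2 * L)) := by gcongr
            _ = B / 2 := by field_simp
        have hD := norm_nonneg D
        constructor
        · refine (h.left.norm_sub_le (M := L * B) (hα.trans hr.1) hrr' (by positivity)
            fun x hx => ?_).trans hlen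
          have hx' : x ∈ Icc α β := ⟨hr.1.trans hx.1.le, hx.2.le.trans hr'.2⟩
          refine (norm_rate_le ha (hα.trans hx'.1) (hle x hx').2).trans ?_
          gcongr
          rw [hL]; nlinarith [sq_nonneg a₁]
        · refine (h.right.norm_sub_le (M := L * B) (hα.trans hr.1) hrr' (by positivity)
            fun x hx => ?_).trans hlen
          have hx' : x ∈ Icc α β := ⟨hr.1.trans hx.1.le, hx.2.le.trans hr'.2⟩
          refine (D.le_opNorm_of_le (hle x hx').1).trans ?_
          gcongr
          rw [hL]; nlinarith [sq_nonneg a₁, mul_nonneg (sq_nonneg a₁) hD]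
      have step' : ∀ r ∈ Icc α β, ∀ r' ∈ Icc α β,
          ‖v r' - v r‖ ≤ B / 2 ∧ ‖w r' - w r‖ ≤ B / 2 := by
        intro r hr r' hr'
        rcases le_total r r' with hle | hle
        · exact step r hr r' hr' hle
        · rw [norm_sub_rev (v r'), norm_sub_rev (w r')]
          exact step r' hr' r hr hle
      have hBt : B ≤ max ‖v t‖ ‖w t‖ + B / 2 := by
        refine csSup_le ⟨r₀, hr₀⟩ ?_
        rintro _ ⟨r, hr, rfl⟩
        have h1 := step' t ht r hr
        have h2 := norm_le_norm_add_norm_sub' (v r) (v t)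
        have h3 := norm_le_norm_add_norm_sub' (w r) (w t)
        exact max_le (by linarith [le_max_left ‖v t‖ ‖w t‖])
          (by linarith [le_max_right ‖v t‖ ‖w t‖])
      have := max_le (hle s hs).1 (hle s hs).2
      linarith)
  refine ⟨|B|, abs_nonneg B, fun t ht => ?_⟩
  exact max_le_iff.1 ((hB t ht).trans (le_abs_self B))

end Wave


/-! ### Galerkin approximation by singular vectors -/

/-- Bessel's inequality for an orthogonal family that may contain zero vectors, as happens for
singular vectors with singular value zero. -/
theorem sum_sq_inner_le_of_orthogonal {H : Type*} [NormedAddCommGroup H] [InnerProductSpace ℝ H]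
    {n : ℕ} {ψ : Fin n → H} {ε : Fin n → ℝ}
    (hε : ∀ i, ε i ≤ 1) (hψ : ∀ i j, inner ℝ (ψ i) (ψ j) = if i = j then ε i else 0) (y : H) :
    ∑ i, inner ℝ (ψ i) y ^ 2 ≤ ‖y‖ ^ 2 := by
  set p := ∑ i, inner ℝ (ψ i) y • ψ i with hp
  have h1 : inner ℝ y p = ∑ i, inner ℝ (ψ i) y ^ 2 := by
    rw [hp, inner_sum]
    refine Finset.sum_congr rfl fun i _ => ?_
    rw [real_inner_smul_right, real_inner_comm, sq]
  have h2 : ‖p‖ ^ 2 ≤ ∑ i, inner ℝ (ψ i) y ^ 2 := by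
    rw [← real_inner_self_eq_norm_sq]
    nth_rw 1 [hp]
    rw [sum_inner]
    refine Finset.sum_le_sum fun i _ => ?_
    rw [real_inner_smul_left, hp, inner_sum]
    simp only [real_inner_smul_right, hψ, mul_ite, mul_zero, Finset.sum_ite_eq, Finset.mem_univ,
      if_true]
    nlinarith [mul_nonneg (sq_nonneg (inner ℝ (ψ i) y)) (sub_nonneg.2 (hε i))]
  have h3 := norm_sub_sq_real y p
  nlinarith [sq_nonneg ‖y - p‖]

/-- Singular vectors of `D` on a finite-dimensional subspace. -/
theorem exists_singular_system {H₁ H₂ : Type*} [NormedAddCommGroup H₁] [InnerProductSpace ℝ H₁]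
    [NormedAddCommGroup H₂] [InnerProductSpace ℝ H₂] [CompleteSpace H₂] (F : Submodule ℝ H₁)
    [FiniteDimensional ℝ F] (D : H₁ →L[ℝ] H₂) :
    ∃ (n : ℕ) (φ : Fin n → H₁) (ψ : Fin n → H₂) (μ : Fin n → ℝ), (∀ i, φ i ∈ F) ∧
      (∀ x, F.starProjection x = ∑ i, inner ℝ (φ i) x • φ i) ∧
      (∀ x, ∑ i, inner ℝ (φ i) x ^ 2 = ‖F.starProjection x‖ ^ 2) ∧
      (∀ i, 0 ≤ μ i ∧ μ i ≤ ‖D‖) ∧ (∀ i, D (φ i) = μ i • ψ i) ∧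
      (∀ i j, inner ℝ (ψ i) (D (φ j)) = if i = j then μ i else 0) ∧
      ∀ y, ∑ i, inner ℝ (ψ i) y ^ 2 ≤ ‖y‖ ^ 2 := by
  have : CompleteSpace F := FiniteDimensional.complete ℝ F
  set E : F →L[ℝ] H₂ := D.comp F.subtypeL with hE
  -- An eigenbasis of `E†E`, where `E` is `D` restricted to `F`, has pairwise orthogonal images
  -- under `D`.
  set A : F →ₗ[ℝ] F := (E.adjoint.comp E : F →L[ℝ] F).toLinearMap with hA
  have hin : ∀ x y : F, inner ℝ (A x) y = inner ℝ (E x) (E y) := fun x y =>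
    E.adjoint_inner_left y (E x)
  have hsym : A.IsSymmetric := fun x y => by
    rw [hin, real_inner_comm (A y) x, hin, real_inner_comm]
  set n := Module.finrank ℝ F
  set b := hsym.eigenvectorBasis (rfl : Module.finrank ℝ F = n) with hb
  set lam := hsym.eigenvalues (rfl : Module.finrank ℝ F = n) with hlam
  have horth : ∀ i j, inner ℝ (D (b i)) (D (b j)) = if i = j then lam i else 0 := by
    intro i j
    have h1 := hin (b i) (b j)
    rw [hsym.apply_eigenvectorBasis, RCLike.ofReal_real_eq_id, id, real_inner_smul_left,
      orthonormal_iff_ite.1 b.orthonormal] at h1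
    change _ = inner ℝ (D (b i)) (D (b j)) at h1
    rw [← h1]
    simp only [mul_ite, mul_one, mul_zero]
    rfl
  have hlam0 : ∀ i, lam i = ‖D (b i)‖ ^ 2 := fun i => by
    have := horth i i
    rw [if_pos rfl, real_inner_self_eq_norm_sq] at this
    exact this.symm
  have hnorm : ∀ i, ‖(b i : H₁)‖ = 1 := fun i => b.orthonormal.1 i
  set μ : Fin n → ℝ := fun i => ‖D (b i)‖ with hμ
  -- If `μ i = 0`, the convention `0⁻¹ = 0` makes `ψ i = 0`, and `D (b i) = μ i • ψ i` still holds.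
  set ψ : Fin n → H₂ := fun i => (μ i)⁻¹ • D (b i) with hψ
  have hDψ : ∀ i, D (b i) = μ i • ψ i := by
    intro i
    by_cases h0 : μ i = 0
    · rw [h0, zero_smul]; exact norm_eq_zero.1 h0
    · rw [hψ]; simp only; rw [smul_smul, mul_inv_cancel₀ h0, one_smul]
  have hψD : ∀ i j, inner ℝ (ψ i) (D (b j)) = if i = j then μ i else 0 := by
    intro i j
    rw [hψ]; simp only
    rw [real_inner_smul_left, horth]
    split_ifs with h
    · rw [hlam0]
      change (μ i)⁻¹ * μ i ^ 2 = μ i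
      by_cases h0 : μ i = 0
      · simp [h0]
      · field_simp
    · simp
  have hproj : ∀ x, F.starProjection x = ∑ i, inner ℝ ((b i : F) : H₁) x • ((b i : F) : H₁) := by
    intro x
    rw [b.starProjection_eq_sum_rankOne]
    simp [InnerProductSpace.rankOne_apply]
  refine ⟨n, fun i => b i, ψ, μ, fun i => (b i).2, hproj, fun x => ?_,
    fun i => ⟨norm_nonneg _, ?_⟩, hDψ, hψD, ?_⟩
  · rw [← real_inner_self_eq_norm_sq]
    nth_rw 2 [hproj]
    rw [inner_sum]
    refine Finset.sum_congr rfl fun i _ => ?_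
    rw [real_inner_smul_right, sq]
    congr 1
    rw [Submodule.inner_starProjection_left_eq_right,
      Submodule.starProjection_eq_self_iff.2 (b i).2, real_inner_comm]
  · have := D.le_opNorm (b i)
    rwa [hnorm, mul_one] at this
  · refine sum_sq_inner_le_of_orthogonal (ε := fun i => (μ i)⁻¹ * μ i) (fun i => inv_mul_le_one)
      fun i j => ?_
    nth_rw 2 [hψ]
    simp only
    rw [real_inner_smul_right, hψD]
    by_cases h : i = j
    · subst h; simp
    · simp [h]

section Galerkin

variable {ι₁ ι₂ H₁ H₂ : Type*} [NormedAddCommGroup H₁] [InnerProductSpace ℝ H₁] [CompleteSpace H₁]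
  [NormedAddCommGroup H₂] [InnerProductSpace ℝ H₂] [CompleteSpace H₂]

variable {b₁ : HilbertBasis ι₁ ℝ H₁} {b₂ : HilbertBasis ι₂ ℝ H₂} {a : ℝ → ℝ} {a₁ : ℝ}
  {D : H₁ →L[ℝ] H₂} {v : ℝ → H₁} {w : ℝ → H₂}

theorem IsWeakWave.exists_lipschitz (h : IsWeakWave b₁ b₂ a D v w)
    (ha : ∀ t, 0 ≤ t → 0 ≤ a t ∧ a t ≤ a₁) {T : ℝ} (hT : 0 ≤ T) :
    ∃ K : NNReal, LipschitzOnWith K v (Icc 0 T) ∧ LipschitzOnWith K w (Icc 0 T) := by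
  obtain ⟨B, hB, hb⟩ := h.exists_bound ha hT
  have h1 := h.left.lipschitzOnWith (T := T) (M := a₁ ^ 2 * ‖D‖ * B) (by positivity)
    fun t ht => norm_rate_le ha ht.1 (hb t ht).2
  have h2 := h.right.lipschitzOnWith (T := T) (M := ‖D‖ * B) (by positivity)
    fun t ht => D.le_opNorm_of_le (hb t ht).1
  exact ⟨_, h1.weaken (le_max_left _ _), h2.weaken (le_max_right _ _)⟩

theorem LipschitzOnWith.absolutelyContinuous_inner {H : Type*} [NormedAddCommGroup H]
    [InnerProductSpace ℝ H] {f : ℝ → H} {K : NNReal} {T : ℝ} (hT : 0 ≤ T)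
    (hf : LipschitzOnWith K f (Icc 0 T)) (x : H) :
    AbsolutelyContinuousOnInterval (fun t => inner ℝ x (f t)) 0 T := by
  have : LipschitzOnWith (‖innerSL ℝ x‖₊ * K) (fun t => inner ℝ x (f t)) (Icc 0 T) :=
    (innerSL ℝ x).lipschitz.comp_lipschitzOnWith hf
  rw [← uIcc_of_le hT] at this
  exact this.absolutelyContinuousOnInterval

theorem absolutelyContinuousOnInterval_sum {n : ℕ} {f : Fin n → ℝ → ℝ} {s t : ℝ} (hst : s ≤ t)
    (hf : ∀ i, AbsolutelyContinuousOnInterval (f i) s t) :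
    AbsolutelyContinuousOnInterval (fun r => ∑ i, f i r) s t := by
  induction n with
  | zero =>
    simp only [Finset.univ_eq_empty, Finset.sum_empty]
    exact absolutelyContinuousOnInterval_of_hasDerivWithinAt hst
      (fun r _ => hasDerivWithinAt_const _ _ _) continuousOn_const
  | succ n ih =>
    simp only [Fin.sum_univ_succ]
    exact (hf 0).fun_add (ih fun i => hf i.succ)

/-- The energy estimate for the part of a wave captured by a finite-dimensional space of positions,
up to the integrated defect of the projection. -/
theorem IsWeakWave.galerkin_estimate (h : IsWeakWave b₁ b₂ a D v w)
    (ha : ∀ t, 0 ≤ t → 0 ≤ a t ∧ a t ≤ a₁) {K : ℝ} (hmode : ModeBound a ‖D‖ K) {T B : ℝ}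
    (hT : 0 ≤ T) (hB : 0 ≤ B) (hb : ∀ t ∈ Icc 0 T, ‖v t‖ ≤ B ∧ ‖w t‖ ≤ B)
    (F : Submodule ℝ H₁) [FiniteDimensional ℝ F] (hF : F ≤ Submodule.span ℝ (range b₁)) :
    ‖F.starProjection (v T)‖ ^ 2 + ‖w T‖ ^ 2 ≤ K * (‖F.starProjection (v 0)‖ ^ 2 + ‖w 0‖ ^ 2 +
      6 * B * ‖D‖ * ∫ t in (0 : ℝ)..T, ‖v t - F.starProjection (v t)‖) ∧
    ‖F.starProjection (v 0)‖ ^ 2 + ‖w 0‖ ^ 2 ≤ K * (‖F.starProjection (v T)‖ ^ 2 + ‖w T‖ ^ 2 +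
      6 * B * ‖D‖ * ∫ t in (0 : ℝ)..T, ‖v t - F.starProjection (v t)‖) := by
  obtain ⟨K₁, hvL, hwL⟩ := h.exists_lipschitz ha hT
  obtain ⟨n, φ, ψ, μ, hφF, hP, hPn, hμ, hDφ, hψD, hbessel⟩ := exists_singular_system F D
  obtain ⟨hK1, hmode⟩ := hmode
  set P := F.starProjection with hPdef
  have hvc := hvL.continuousOn
  have hwc := hwL.continuousOn
  set ρ : ℝ → ℝ := fun t => ‖v t - P (v t)‖ with hρ
  have hρc : ContinuousOn ρ (Icc 0 T) := (hvc.sub (P.continuous.comp_continuousOn hvc)).norm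
  have hρi : IntervalIntegrable ρ volume 0 T := by
    apply ContinuousOn.intervalIntegrable; rwa [uIcc_of_le hT]
  set V : Fin n → ℝ → ℝ := fun i t => inner ℝ (φ i) (v t) with hV
  set Z : Fin n → ℝ → ℝ := fun i t => inner ℝ (ψ i) (w t) with hZ
  -- The part of `v` outside `F` enters the equation for `Z i` only, as a force.
  set g : Fin n → ℝ → ℝ := fun i t => inner ℝ (ψ i) (D (v t - P (v t))) with hg
  have hwd : ∀ t ∈ Ioo 0 T, HasDerivAt w (D (v t)) t := fun t ht =>
    h.right.hasDerivAt ht.1 (D.continuous.continuousAt.comp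
      (hvc.continuousAt (Icc_mem_nhds ht.1 ht.2)))
  have hDP : ∀ t, D (v t) = (∑ j, V j t • D (φ j)) + D (v t - P (v t)) := by
    intro t
    have : D (P (v t)) = ∑ j, V j t • D (φ j) := by rw [hP]; simp [hV]
    rw [← this, ← map_add]; congr 1; abel
  have hZd : ∀ i, ∀ t ∈ Ioo 0 T, HasDerivAt (Z i) (μ i * V i t + g i t) t := by
    intro i t ht
    have h1 := ((innerSL ℝ (ψ i)).hasFDerivAt (x := w t)).comp_hasDerivAt t (hwd t ht)
    have e : innerSL ℝ (ψ i) (D (v t)) = μ i * V i t + g i t := by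
      rw [innerSL_apply_apply, hDP, inner_add_right, inner_sum]
      simp only [real_inner_smul_right, hψD, mul_ite, mul_zero, Finset.sum_ite_eq,
        Finset.mem_univ, if_true, hg]
      ring
    rw [e] at h1
    exact h1
  have hmodes : ∀ i, IsMode a (μ i) T (g i) (V i) (Z i) := fun i =>
    { ac_v := LipschitzOnWith.absolutelyContinuous_inner hT hvL (φ i)
      ac_z := LipschitzOnWith.absolutelyContinuous_inner hT hwL (ψ i)
      -- This equation has no error term: the adjoint moves `D` onto `φ i ∈ F`, where `D (φ i) = μ i
      -- • ψ i`.
      deriv_v := by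
        filter_upwards [h.left.deriv_span (hF (hφF i))] with t ht htm
        have e : inner ℝ (φ i) (-(a t ^ 2) • D.adjoint (w t)) = -(a t ^ 2 * μ i * Z i t) := by
          rw [real_inner_smul_right, ContinuousLinearMap.adjoint_inner_right, hDφ,
            real_inner_smul_left]
          ring
        rw [← e]
        exact ht htm.1
      deriv_z := Filter.Eventually.of_forall fun t ht => hZd i t ht
      cont_g := continuousOn_const.inner
        (D.continuous.comp_continuousOn (hvc.sub (P.continuous.comp_continuousOn hvc))) }
  have hcmp := fun i => hmode (μ i) T (hμ i).1 (hμ i).2 hT (g i) (V i) (Z i) (hmodes i)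
  have hPle : ∀ x, ‖P x‖ ≤ ‖x‖ := fun x => F.norm_starProjection_apply_le x
  have hgle : ∀ t, ∑ i, g i t ^ 2 ≤ (‖D‖ * ρ t) ^ 2 := fun t =>
    (hbessel _).trans (by gcongr; exact D.le_opNorm _)
  have hZle : ∀ t ∈ Icc 0 T, ∑ i, Z i t ^ 2 ≤ B ^ 2 := fun t ht =>
    (hbessel _).trans (by gcongr; exact (hb t ht).2)
  have hVle : ∀ t ∈ Icc 0 T, ∑ i, V i t ^ 2 ≤ B ^ 2 := fun t ht => by
    rw [show ∑ i, V i t ^ 2 = ‖P (v t)‖ ^ 2 from hPn (v t)]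
    gcongr
    exact (hPle _).trans (hb t ht).1
  have hρ0 : ∀ t, 0 ≤ ρ t := fun t => norm_nonneg _
  have hwork : ∑ i, modeWork (g i) (V i) (Z i) 0 T ≤ 2 * B * ‖D‖ * ∫ t in (0 : ℝ)..T, ρ t := by
    simp only [modeWork]
    rw [← intervalIntegral.integral_finsetSum fun i _ =>
      (hmodes i).intervalIntegrable_work le_rfl hT le_rfl, ← intervalIntegral.integral_const_mul]
    refine intervalIntegral.integral_mono_on hT (by
      simpa only [Finset.sum_fn] using IntervalIntegrable.sum Finset.univ fun i _ =>
        (hmodes i).intervalIntegrable_work le_rfl hT le_rfl) (hρi.const_mul _) fun t ht => ?_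
    refine (Real.sum_mul_le_sqrt_mul_sqrt _ _ _).trans ?_
    have h1 : √(∑ i, √(V i t ^ 2 + Z i t ^ 2) ^ 2) ≤ 2 * B := by
      refine Real.sqrt_le_iff.2 ⟨by positivity, ?_⟩
      have : ∀ i, √(V i t ^ 2 + Z i t ^ 2) ^ 2 = V i t ^ 2 + Z i t ^ 2 := fun i =>
        Real.sq_sqrt (by positivity)
      simp only [this, Finset.sum_add_distrib]
      nlinarith [hVle t ht, hZle t ht]
    have h2 : √(∑ i, |g i t| ^ 2) ≤ ‖D‖ * ρ t := by
      refine Real.sqrt_le_iff.2 ⟨mul_nonneg (norm_nonneg _) (hρ0 t), ?_⟩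
      simpa only [sq_abs] using hgle t
    calc _ ≤ 2 * B * (‖D‖ * ρ t) := by gcongr
      _ = _ := by ring
  -- `R` is the part of `‖w‖²` not seen by the `ψ i`, nonnegative by Bessel. In its derivative the
  -- terms `μ i V i Z i` cancel and only the projection defect remains.
  set R : ℝ → ℝ := fun t => ‖w t‖ * ‖w t‖ - ∑ i, Z i t * Z i t with hR
  have hnac : AbsolutelyContinuousOnInterval (fun t => ‖w t‖) 0 T := by
    have : LipschitzOnWith (1 * K₁) (fun t => ‖w t‖) (uIcc 0 T) := by
      rw [uIcc_of_le hT]; exact lipschitzWith_one_norm.comp_lipschitzOnWith hwL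
    exact this.absolutelyContinuousOnInterval
  have hRac : AbsolutelyContinuousOnInterval R 0 T :=
    (hnac.fun_mul hnac).fun_sub (absolutelyContinuousOnInterval_sum hT fun i =>
      (hmodes i).ac_z.fun_mul (hmodes i).ac_z)
  have hrest := gronwall_of_absolutelyContinuous (b := fun _ => 0)
    (g := fun t => 4 * B * ‖D‖ * ρ t) hT hRac (by simp) (fun _ _ => le_rfl)
    (hρi.const_mul _) (fun t _ => mul_nonneg (by positivity) (hρ0 t))
    (Filter.Eventually.of_forall fun t ht => by
      have ht' := Ioo_subset_Icc_self ht
      have h1 : HasDerivAt (fun t => ‖w t‖ * ‖w t‖) (2 * inner ℝ (w t) (D (v t))) t := by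
        have := (hwd t ht).norm_sq
        simpa only [sq] using this
      have h2 : HasDerivAt (fun t => ∑ i, Z i t * Z i t)
          (∑ i, ((μ i * V i t + g i t) * Z i t + Z i t * (μ i * V i t + g i t))) t :=
        HasDerivAt.fun_sum fun i _ => (hZd i t ht).fun_mul (hZd i t ht)
      refine ⟨_, h1.fun_sub h2, ?_⟩
      have e : 2 * inner ℝ (w t) (D (v t)) -
          ∑ i, ((μ i * V i t + g i t) * Z i t + Z i t * (μ i * V i t + g i t)) =
          2 * inner ℝ (w t) (D (v t - P (v t))) - 2 * ∑ i, Z i t * g i t := by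
        have e1 : inner ℝ (w t) (D (v t)) =
            ∑ i, μ i * V i t * Z i t + inner ℝ (w t) (D (v t - P (v t))) := by
          rw [hDP, inner_add_right, inner_sum]
          congr 1
          refine Finset.sum_congr rfl fun i _ => ?_
          rw [real_inner_smul_right, hDφ, real_inner_smul_right, real_inner_comm]
          ring
        rw [e1, mul_add, Finset.mul_sum, Finset.mul_sum, add_sub_right_comm,
          ← Finset.sum_sub_distrib, add_comm, sub_eq_add_neg _ (∑ i, 2 * (Z i t * g i t)),
          ← Finset.sum_neg_distrib]
        congr 1
        exact Finset.sum_congr rfl fun i _ => by ring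
      rw [e, zero_mul, zero_add]
      have b1 : |inner ℝ (w t) (D (v t - P (v t)))| ≤ B * (‖D‖ * ρ t) := by
        refine (abs_real_inner_le_norm _ _).trans ?_
        exact mul_le_mul (hb t ht').2 (D.le_opNorm _) (norm_nonneg _) hB
      have b2 : |∑ i, Z i t * g i t| ≤ B * (‖D‖ * ρ t) := by
        refine (Finset.abs_sum_le_sum_abs _ _).trans ?_
        simp only [abs_mul]
        refine (Real.sum_mul_le_sqrt_mul_sqrt _ _ _).trans ?_
        have h1 : √(∑ i, |Z i t| ^ 2) ≤ B := by
          refine Real.sqrt_le_iff.2 ⟨hB, ?_⟩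
          simpa only [sq_abs] using hZle t ht'
        have h2 : √(∑ i, |g i t| ^ 2) ≤ ‖D‖ * ρ t := by
          refine Real.sqrt_le_iff.2 ⟨mul_nonneg (norm_nonneg _) (hρ0 t), ?_⟩
          simpa only [sq_abs] using hgle t
        gcongr
      rw [abs_le] at b1 b2 ⊢
      constructor <;> linarith)
  rw [intervalIntegral.integral_zero, Real.exp_zero, one_mul, one_mul,
    intervalIntegral.integral_const_mul] at hrest
  have hI0 : 0 ≤ ∫ t in (0 : ℝ)..T, ρ t := intervalIntegral.integral_nonneg hT fun t _ => hρ0 t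
  have hR0 : ∀ t, 0 ≤ R t := fun t => by
    have := hbessel (w t)
    simp only [hR, ← sq]
    exact sub_nonneg.2 this
  have hsplit : ∀ t, ‖P (v t)‖ ^ 2 + ‖w t‖ ^ 2 = ∑ i, (V i t ^ 2 + Z i t ^ 2) + R t := by
    intro t
    rw [Finset.sum_add_distrib, show ∑ i, V i t ^ 2 = ‖P (v t)‖ ^ 2 from hPn (v t)]
    simp only [hR, ← sq]
    ring
  have hfin : ∀ s t, (∀ i, V i t ^ 2 + Z i t ^ 2 ≤
      K * (V i s ^ 2 + Z i s ^ 2 + modeWork (g i) (V i) (Z i) 0 T)) →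
      R t ≤ R s + 4 * B * ‖D‖ * ∫ t in (0 : ℝ)..T, ρ t →
      ‖P (v t)‖ ^ 2 + ‖w t‖ ^ 2 ≤ K * (‖P (v s)‖ ^ 2 + ‖w s‖ ^ 2 +
        6 * B * ‖D‖ * ∫ t in (0 : ℝ)..T, ρ t) := by
    intro s t h1 h2
    rw [hsplit, hsplit]
    have h3 := Finset.sum_le_sum fun i (_ : i ∈ Finset.univ) => h1 i
    rw [← Finset.mul_sum, Finset.sum_add_distrib (f := fun i => V i s ^ 2 + Z i s ^ 2)] at h3
    set I := ∫ t in (0 : ℝ)..T, ρ t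
    have h4 : R t ≤ K * (R s + 4 * B * ‖D‖ * I) := h2.trans (le_mul_of_one_le_left
      (add_nonneg (hR0 s) (by positivity)) hK1)
    have h5 : K * (∑ i, (V i s ^ 2 + Z i s ^ 2) + ∑ i, modeWork (g i) (V i) (Z i) 0 T) ≤
        K * (∑ i, (V i s ^ 2 + Z i s ^ 2) + 2 * B * ‖D‖ * I) := by gcongr
    -- The constant `6` is `2` from the work of the forces plus `4` from the drift of `R`.
    nlinarith
  exact ⟨hfin 0 T (fun i => (hcmp i).1) hrest.1, hfin T 0 (fun i => (hcmp i).2) hrest.2⟩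

open Filter Topology in
/-- Mode estimates imply the energy estimate for waves. -/
theorem IsWeakWave.energy_comparable [Countable ι₁] (h : IsWeakWave b₁ b₂ a D v w)
    (ha : ∀ t, 0 ≤ t → 0 ≤ a t ∧ a t ≤ a₁) {K : ℝ} (hmode : ModeBound a ‖D‖ K) {T : ℝ}
    (hT : 0 ≤ T) : ‖v T‖ ^ 2 + ‖w T‖ ^ 2 ≤ K * (‖v 0‖ ^ 2 + ‖w 0‖ ^ 2) ∧
      ‖v 0‖ ^ 2 + ‖w 0‖ ^ 2 ≤ K * (‖v T‖ ^ 2 + ‖w T‖ ^ 2) := by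
  classical
  obtain ⟨B, hB, hb⟩ := h.exists_bound ha hT
  obtain ⟨K₁, hvL, hwL⟩ := h.exists_lipschitz ha hT
  have hvc := hvL.continuousOn
  set U : Finset ι₁ → Submodule ℝ H₁ := fun s => Submodule.span ℝ (s.image b₁ : Finset H₁) with hU
  have hmono : Monotone U := fun s t hst =>
    Submodule.span_mono (by exact_mod_cast Finset.image_subset_image hst)
  have hle : ∀ s, U s ≤ Submodule.span ℝ (range b₁) := fun s =>
    Submodule.span_mono (by rw [Finset.coe_image]; exact image_subset_range _ _)
  have htop : ⊤ ≤ (⨆ s, U s).topologicalClosure := by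
    rw [← b₁.dense_span]
    refine Submodule.topologicalClosure_mono (Submodule.span_le.2 ?_)
    rintro _ ⟨k, rfl⟩
    exact (le_iSup U {k}) (Submodule.subset_span (by simp))
  have hlim : ∀ x, Tendsto (fun s => (U s).starProjection x) atTop (𝓝 x) := fun x =>
    Submodule.starProjection_tendsto_self U hmono x htop
  have hint : Tendsto (fun s => ∫ t in (0 : ℝ)..T, ‖v t - (U s).starProjection (v t)‖) atTop
      (𝓝 (∫ t in (0 : ℝ)..T, (0 : ℝ))) := by
    -- Countability of `ι₁` makes the filter of finite index sets countably generated, as dominated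
    -- convergence requires.
    refine intervalIntegral.tendsto_integral_filter_of_dominated_convergence (fun _ => 2 * B)
      (Eventually.of_forall fun s => ?_) (Eventually.of_forall fun s => ?_) (by simp) ?_
    · refine ContinuousOn.aestronglyMeasurable ?_ measurableSet_uIoc
      rw [uIoc_of_le hT]
      exact (hvc.sub ((U s).starProjection.continuous.comp_continuousOn hvc)).norm.mono
        Ioc_subset_Icc_self
    · refine Eventually.of_forall fun t ht => ?_
      rw [uIoc_of_le hT] at ht
      rw [norm_norm]
      have h1 := (hb t (Ioc_subset_Icc_self ht)).1
      have h2 := (U s).norm_starProjection_apply_le (v t)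
      linarith [norm_sub_le (v t) ((U s).starProjection (v t))]
    · refine Eventually.of_forall fun t _ => ?_
      simpa using ((hlim (v t)).const_sub (v t)).norm
  rw [intervalIntegral.integral_zero] at hint
  have hE : ∀ t, Tendsto (fun s => ‖(U s).starProjection (v t)‖ ^ 2 + ‖w t‖ ^ 2) atTop
      (𝓝 (‖v t‖ ^ 2 + ‖w t‖ ^ 2)) := fun t => ((hlim (v t)).norm.pow 2).add_const _
  have hRHS : ∀ t, Tendsto (fun s => K * (‖(U s).starProjection (v t)‖ ^ 2 + ‖w t‖ ^ 2 +
      6 * B * ‖D‖ * ∫ t in (0 : ℝ)..T, ‖v t - (U s).starProjection (v t)‖)) atTop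
      (𝓝 (K * (‖v t‖ ^ 2 + ‖w t‖ ^ 2))) := fun t => by
    simpa using ((hE t).add (hint.const_mul (6 * B * ‖D‖))).const_mul K
  have hest := fun s => h.galerkin_estimate ha hmode hT hB hb (U s) (hle s)
  exact ⟨le_of_tendsto_of_tendsto' (hE T) (hRHS 0) fun s => (hest s).1,
    le_of_tendsto_of_tendsto' (hE 0) (hRHS T) fun s => (hest s).2⟩

end Galerkin


/-! ### The lattice -/

theorem memℓp_two_iff {ι E : Type*} [NormedAddCommGroup E] {f : ι → E} :
    Memℓp f 2 ↔ Summable fun i => ‖f i‖ ^ 2 := by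
  rw [memℓp_gen_iff (by norm_num)]
  norm_num

theorem lp_norm_sq {ι : Type*} (x : lp (fun _ : ι => ℝ) 2) : ‖x‖ ^ 2 = ∑' i, x i ^ 2 := by
  have := lp.norm_rpow_eq_tsum (p := 2) (by norm_num) x
  norm_num at this
  exact this

/-- The standard Hilbert basis of `ℓ²`. -/
noncomputable def stdBasis (ι : Type*) : HilbertBasis ι ℝ (lp (fun _ : ι => ℝ) 2) :=
  HilbertBasis.ofRepr (LinearIsometryEquiv.refl ℝ _)

theorem inner_stdBasis {ι : Type*} (k : ι) (x : lp (fun _ : ι => ℝ) 2) :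
    inner ℝ (stdBasis ι k) x = x k :=
  ((stdBasis ι).repr_apply_apply x k).symm

theorem stdBasis_apply {ι : Type*} [DecidableEq ι] (k l : ι) :
    (stdBasis ι k : ι → ℝ) l = if l = k then 1 else 0 := by
  rw [← inner_stdBasis, orthonormal_iff_ite.1 (stdBasis ι).orthonormal]

variable {d : ℕ}

theorem summable_lattice_prod {g : Fin d × (Fin d → ℤ) → ℝ} (h0 : ∀ p, 0 ≤ g p)
    (h : ∀ j, Summable fun k => g (j, k)) : Summable g :=
  (summable_prod_of_nonneg h0).2 ⟨h, Summable.of_finite⟩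

theorem summable_sq_shift {f : (Fin d → ℤ) → ℝ} (hf : Summable fun k => f k ^ 2)
    (e : Fin d → ℤ) : (Summable fun k => f (k + e) ^ 2) ∧
      ∑' k, f (k + e) ^ 2 = ∑' k, f k ^ 2 :=
  ⟨(Equiv.addRight e).summable_iff (f := fun k => f k ^ 2) |>.2 hf,
    (Equiv.addRight e).tsum_eq fun k => f k ^ 2⟩

theorem summable_sq_forward {f : (Fin d → ℤ) → ℝ} (hf : Summable fun k => f k ^ 2)
    (e : Fin d → ℤ) : (Summable fun k => (f (k + e) - f k) ^ 2) ∧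
      ∑' k, (f (k + e) - f k) ^ 2 ≤ 4 * ∑' k, f k ^ 2 := by
  obtain ⟨h1, h2⟩ := summable_sq_shift hf e
  have hs := (h1.mul_left 2).add (hf.mul_left 2)
  have hle : ∀ k, (f (k + e) - f k) ^ 2 ≤ 2 * f (k + e) ^ 2 + 2 * f k ^ 2 := fun k => by
    nlinarith [sq_nonneg (f (k + e) + f k)]
  have hsum : Summable fun k => (f (k + e) - f k) ^ 2 :=
    Summable.of_nonneg_of_le (fun k => sq_nonneg _) hle hs
  refine ⟨hsum, (hsum.tsum_le_tsum hle hs).trans (le_of_eq ?_)⟩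
  rw [(h1.mul_left 2).tsum_add (hf.mul_left 2), tsum_mul_left, tsum_mul_left, h2]
  ring

theorem summable_sq_lp {ι : Type*} (x : lp (fun _ : ι => ℝ) 2) : Summable fun k => x k ^ 2 := by
  simpa using memℓp_two_iff.1 (lp.memℓp x)

theorem memℓp_gradient (x : lp (fun _ : Fin d → ℤ => ℝ) 2) :
    Memℓp (fun p : Fin d × (Fin d → ℤ) => x (p.2 + Pi.single p.1 1) - x p.2) 2 := by
  rw [memℓp_two_iff]
  refine summable_lattice_prod (fun p => by positivity) fun j => ?_
  simpa using (summable_sq_forward (summable_sq_lp x) (Pi.single j 1)).1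

/-- The forward gradient on `ℓ²(ℤ^d)`. -/
noncomputable def gradient (d : ℕ) :
    lp (fun _ : Fin d → ℤ => ℝ) 2 →L[ℝ] lp (fun _ : Fin d × (Fin d → ℤ) => ℝ) 2 :=
  LinearMap.mkContinuous
    { toFun := fun x => ⟨_, memℓp_gradient x⟩
      map_add' := fun x y => by
        ext p
        simp only [lp.coeFn_add, Pi.add_apply]
        ring
      map_smul' := fun c x => by
        ext p
        simp only [lp.coeFn_smul, Pi.smul_apply, smul_eq_mul, RingHom.id_apply]
        ring }
    (√(4 * d)) (fun x => by
      refine (pow_le_pow_iff_left₀ (norm_nonneg _) (by positivity) two_ne_zero).1 ?_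
      rw [mul_pow, Real.sq_sqrt (by positivity), lp_norm_sq, lp_norm_sq]
      have hs := summable_sq_lp (⟨_, memℓp_gradient x⟩ : lp (fun _ : Fin d × (Fin d → ℤ) => ℝ) 2)
      refine le_trans (le_of_eq (hs.tsum_prod)) ?_
      rw [tsum_fintype]
      calc _ ≤ ∑ _j : Fin d, 4 * ∑' k, x k ^ 2 := Finset.sum_le_sum fun j _ =>
            (summable_sq_forward (summable_sq_lp x) (Pi.single j 1)).2
        _ = _ := by simp; ring)

theorem gradient_apply (x : lp (fun _ : Fin d → ℤ => ℝ) 2) (j : Fin d) (k : Fin d → ℤ) :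
    (gradient d x : Fin d × (Fin d → ℤ) → ℝ) (j, k) = x (k + Pi.single j 1) - x k := rfl

/-- This computes the coordinates of the adjoint: `D†y = -∑ D_j^- y_j`, so `-D†D` is the discrete
Laplacian. -/
theorem inner_gradient_stdBasis (k : Fin d → ℤ) (y : lp (fun _ : Fin d × (Fin d → ℤ) => ℝ) 2) :
    inner ℝ (gradient d (stdBasis _ k)) y = ∑ j, (y (j, k - Pi.single j 1) - y (j, k)) := by
  have e : gradient d (stdBasis _ k) =
      ∑ j, (stdBasis _ (j, k - Pi.single j 1) - stdBasis _ (j, k)) := by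
    ext ⟨j, l⟩
    rw [gradient_apply, lp.coeFn_sum, Finset.sum_apply]
    simp only [lp.coeFn_sub, Pi.sub_apply, stdBasis_apply, Prod.mk.injEq, Finset.sum_sub_distrib]
    congr 1
    · rw [Finset.sum_eq_single j]
      · simp [eq_sub_iff_add_eq]
      · intro j' _ hj'; simp [Ne.symm hj']
      · simp
    · rw [Finset.sum_eq_single j]
      · simp
      · intro j' _ hj'; simp [Ne.symm hj']
      · simp
  rw [e, sum_inner]
  simp only [inner_sub_left, inner_stdBasis]

/-! ### Real components of lattice solutions as weak waves. -/

section Solution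

variable {a : ℝ → ℝ} {u₀ u₁ : (Fin d → ℤ) → ℂ} {u : ℝ → (Fin d → ℤ) → ℂ} {π : ℂ →L[ℝ] ℝ}

theorem Memℓp.map_clm {ι : Type*} {f : ι → ℂ} (hf : Memℓp f 2) (π : ℂ →L[ℝ] ℝ) :
    Memℓp (fun i => π (f i)) 2 := by
  rw [memℓp_two_iff] at hf ⊢
  refine Summable.of_nonneg_of_le (fun i => by positivity) (fun i => ?_) (hf.mul_left (‖π‖ ^ 2))
  rw [← mul_pow]
  gcongr
  exact π.le_opNorm _

theorem IsSolution.memℓp_velocity (h : IsSolution a u₀ u₁ u) (π : ℂ →L[ℝ] ℝ) {t : ℝ}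
    (ht : 0 ≤ t) : Memℓp (fun k => π (velocity u t k)) 2 :=
  Memℓp.map_clm (h.velocity_mem t ht) π

theorem IsSolution.memℓp_gradient (h : IsSolution a u₀ u₁ u) (π : ℂ →L[ℝ] ℝ) {t : ℝ}
    (ht : 0 ≤ t) :
    Memℓp (fun p : Fin d × (Fin d → ℤ) => π (forwardDiff p.1 (u t) p.2)) 2 := by
  rw [memℓp_two_iff]
  exact summable_lattice_prod (fun p => by positivity) fun j =>
    memℓp_two_iff.1 (Memℓp.map_clm (h.forwardDiff_mem t ht j) π)

open Classical in
/-- A real component of the velocity as a curve in `ℓ²`. -/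
noncomputable def velocityPart (π : ℂ →L[ℝ] ℝ) (u : ℝ → (Fin d → ℤ) → ℂ) (t : ℝ) :
    lp (fun _ : Fin d → ℤ => ℝ) 2 :=
  if h : Memℓp (fun k => π (velocity u t k)) 2 then ⟨_, h⟩ else 0

open Classical in
/-- A real component of the spatial gradient as a curve in `ℓ²`. -/
noncomputable def gradientPart (π : ℂ →L[ℝ] ℝ) (u : ℝ → (Fin d → ℤ) → ℂ) (t : ℝ) :
    lp (fun _ : Fin d × (Fin d → ℤ) => ℝ) 2 :=
  if h : Memℓp (fun p : Fin d × (Fin d → ℤ) => π (forwardDiff p.1 (u t) p.2)) 2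
  then ⟨_, h⟩ else 0

theorem IsSolution.velocityPart_apply (h : IsSolution a u₀ u₁ u) (π : ℂ →L[ℝ] ℝ) {t : ℝ}
    (ht : 0 ≤ t) (k : Fin d → ℤ) : velocityPart π u t k = π (velocity u t k) := by
  rw [velocityPart, dif_pos (h.memℓp_velocity π ht)]

theorem IsSolution.gradientPart_apply (h : IsSolution a u₀ u₁ u) (π : ℂ →L[ℝ] ℝ) {t : ℝ}
    (ht : 0 ≤ t) (j : Fin d) (k : Fin d → ℤ) :
    gradientPart π u t (j, k) = π (u t (k + Pi.single j 1)) - π (u t k) := by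
  rw [gradientPart, dif_pos (h.memℓp_gradient π ht), ← map_sub]
  rfl

theorem IsSolution.hasDerivWithinAt (h : IsSolution a u₀ u₁ u) (π : ℂ →L[ℝ] ℝ) (k : Fin d → ℤ)
    {t : ℝ} (ht : 0 ≤ t) :
    HasDerivWithinAt (fun s => π (u s k)) (π (velocity u t k)) (Ici 0) t :=
  π.hasFDerivAt.comp_hasDerivWithinAt t ((h.differentiableOn k) t ht).hasDerivWithinAt

theorem IsSolution.ac_velocity (h : IsSolution a u₀ u₁ u) (π : ℂ →L[ℝ] ℝ) (k : Fin d → ℤ) {T : ℝ}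
    (hT : 0 ≤ T) : AbsolutelyContinuousOnInterval (fun t => π (velocity u t k)) 0 T :=
  absolutelyContinuousOnInterval_lipschitz_comp (φ := π) (h.absolutelyContinuous k T hT)
    (π.lipschitz.lipschitzOnWith (s := univ)) fun _ _ => mem_univ _

theorem IsSolution.ac_position (h : IsSolution a u₀ u₁ u) (π : ℂ →L[ℝ] ℝ) (k : Fin d → ℤ) {T : ℝ}
    (hT : 0 ≤ T) : AbsolutelyContinuousOnInterval (fun t => π (u t k)) 0 T := by
  have hc := (h.ac_velocity π k hT).continuousOn
  rw [uIcc_of_le hT] at hc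
  exact absolutelyContinuousOnInterval_of_hasDerivWithinAt hT
    (fun r hr => (h.hasDerivWithinAt π k hr.1).mono Icc_subset_Ici_self) hc

theorem discreteLaplacian_apply (f : (Fin d → ℤ) → ℂ) (k : Fin d → ℤ) :
    discreteLaplacian f k =
      ∑ j, ((f (k + Pi.single j 1) - f k) - (f k - f (k - Pi.single j 1))) := by
  simp only [discreteLaplacian, forwardDiff, backwardDiff, add_sub_cancel_right]

/-- The unknowns are the velocity and the gradient, since `u(t)` itself need not belong to ℓ².
Because `a` is real, any real-linear functional `π` of the values commutes with the equation. -/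
theorem IsSolution.isWeakWave (h : IsSolution a u₀ u₁ u) (π : ℂ →L[ℝ] ℝ) :
    IsWeakWave (stdBasis (Fin d → ℤ)) (stdBasis (Fin d × (Fin d → ℤ))) a (gradient d)
      (velocityPart π u) (gradientPart π u) where
  left :=
    { ac := fun k T hT => absolutelyContinuousOnInterval_congr (h.ac_velocity π k hT) fun t ht => by
        rw [uIcc_of_le hT] at ht
        simp only [inner_stdBasis, h.velocityPart_apply π ht.1]
      deriv := fun k => by
        filter_upwards [h.equation k] with t ht ht0
        have h1 := (π.hasFDerivAt.comp_hasDerivAt t (ht ht0))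
        have e : inner ℝ (stdBasis _ k) (-(a t ^ 2) • (gradient d).adjoint (gradientPart π u t)) =
            π (((a t) ^ 2 : ℝ) * discreteLaplacian (u t) k) := by
          rw [← Complex.real_smul, map_smul, real_inner_smul_right,
            ContinuousLinearMap.adjoint_inner_right, inner_gradient_stdBasis,
            discreteLaplacian_apply, map_sum, smul_eq_mul, neg_mul, ← mul_neg,
            ← Finset.sum_neg_distrib]
          congr 1
          refine Finset.sum_congr rfl fun j _ => ?_
          rw [h.gradientPart_apply π ht0.le, h.gradientPart_apply π ht0.le, sub_add_cancel]
          simp only [map_sub]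
          ring
        rw [e]
        refine h1.congr_of_eventuallyEq ?_
        filter_upwards [Ioi_mem_nhds ht0] with s hs
        simp only [inner_stdBasis, h.velocityPart_apply π (le_of_lt hs), Function.comp_apply] }
  right :=
    { ac := fun p T hT => by
        obtain ⟨j, k⟩ := p
        refine absolutelyContinuousOnInterval_congr
          ((h.ac_position π (k + Pi.single j 1) hT).fun_sub (h.ac_position π k hT)) fun t ht => ?_
        rw [uIcc_of_le hT] at ht
        simp only [inner_stdBasis, h.gradientPart_apply π ht.1]
      deriv := fun p => by
        obtain ⟨j, k⟩ := p
        refine Filter.Eventually.of_forall fun t ht0 => ?_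
        have hd := fun k => (h.hasDerivWithinAt π k ht0.le).hasDerivAt (Ici_mem_nhds ht0)
        rw [inner_stdBasis, gradient_apply, h.velocityPart_apply π ht0.le,
          h.velocityPart_apply π ht0.le]
        refine ((hd (k + Pi.single j 1)).fun_sub (hd k)).congr_of_eventuallyEq ?_
        filter_upwards [Ioi_mem_nhds ht0] with s hs
        simp only [inner_stdBasis, h.gradientPart_apply π (le_of_lt hs)] }

theorem sq_reCLM_add_sq_imCLM (z : ℂ) :
    Complex.reCLM z ^ 2 + Complex.imCLM z ^ 2 = ‖z‖ ^ 2 := by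
  rw [Complex.sq_norm, Complex.normSq_apply, Complex.reCLM_apply, Complex.imCLM_apply]
  ring

theorem IsSolution.kinetic_eq (h : IsSolution a u₀ u₁ u) {t : ℝ} (ht : 0 ≤ t) :
    ∑' k, ‖velocity u t k‖ ^ 2 =
      ‖velocityPart Complex.reCLM u t‖ ^ 2 + ‖velocityPart Complex.imCLM u t‖ ^ 2 := by
  rw [lp_norm_sq, lp_norm_sq, ← (summable_sq_lp _).tsum_add (summable_sq_lp _)]
  refine tsum_congr fun k => ?_
  rw [h.velocityPart_apply _ ht, h.velocityPart_apply _ ht, sq_reCLM_add_sq_imCLM]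

theorem IsSolution.potential_eq (h : IsSolution a u₀ u₁ u) {t : ℝ} (ht : 0 ≤ t) :
    ∑ j : Fin d, ∑' k, ‖forwardDiff j (u t) k‖ ^ 2 =
      ‖gradientPart Complex.reCLM u t‖ ^ 2 + ‖gradientPart Complex.imCLM u t‖ ^ 2 := by
  have hs := (summable_sq_lp (gradientPart Complex.reCLM u t)).add
    (summable_sq_lp (gradientPart Complex.imCLM u t))
  rw [lp_norm_sq, lp_norm_sq, ← (summable_sq_lp _).tsum_add (summable_sq_lp _), hs.tsum_prod,
    tsum_fintype]
  refine Finset.sum_congr rfl fun j _ => tsum_congr fun k => ?_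
  rw [h.gradientPart_apply _ ht, h.gradientPart_apply _ ht, ← map_sub, ← map_sub,
    sq_reCLM_add_sq_imCLM]
  rfl

end Solution

/-- The wave estimate is applied to real and imaginary parts and summed. Replacing `‖v‖² + ‖w‖²` by
the energy, which weights `‖w‖²` with `a² ∈ [a₀², a₁²]`, costs the factor `max 1 a₁² / min 1 a₀²`.
-/
theorem gec_of_modeBound {a : ℝ → ℝ} {a₀ a₁ : ℝ} (ha₀ : 0 < a₀)
    (ha : ∀ t, 0 ≤ t → a₀ ≤ a t ∧ a t ≤ a₁) (hmode : ∀ M, ∃ K, ModeBound a M K) : GEC d a := by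
  obtain ⟨K, hK⟩ := hmode ‖gradient d‖
  have hK0 : 0 < K := by linarith [hK.1]
  have ha₁ : 0 < a₁ := by have := ha 0 le_rfl; linarith
  have ha' : ∀ t, 0 ≤ t → 0 ≤ a t ∧ a t ≤ a₁ := fun t ht => ⟨ha₀.le.trans (ha t ht).1, (ha t ht).2⟩
  have hc : 0 < min 1 (a₀ ^ 2) := by positivity
  refine ⟨max 1 (a₁ ^ 2) * K / min 1 (a₀ ^ 2), by positivity, fun u₀ u₁ u h t ht => ?_⟩
  have hre := (h.isWeakWave Complex.reCLM).energy_comparable ha' hK ht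
  have him := (h.isWeakWave Complex.imCLM).energy_comparable ha' hK ht
  have key : ∀ s, 0 ≤ s → ∃ e : ℝ, 0 ≤ e ∧ min 1 (a₀ ^ 2) * e ≤ energy a u s ∧
      energy a u s ≤ max 1 (a₁ ^ 2) * e ∧
      e = (‖velocityPart Complex.reCLM u s‖ ^ 2 + ‖gradientPart Complex.reCLM u s‖ ^ 2) +
        (‖velocityPart Complex.imCLM u s‖ ^ 2 + ‖gradientPart Complex.imCLM u s‖ ^ 2) := by
    intro s hs
    refine ⟨_, by positivity, ?_, ?_, rfl⟩ <;> rw [energy, h.kinetic_eq hs, h.potential_eq hs]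
    · have h1 : min 1 (a₀ ^ 2) ≤ a s ^ 2 := (min_le_right _ _).trans (by gcongr; exact (ha s hs).1)
      have h2 := min_le_left 1 (a₀ ^ 2)
      have := sq_nonneg ‖velocityPart Complex.reCLM u s‖
      have := sq_nonneg ‖velocityPart Complex.imCLM u s‖
      have := sq_nonneg ‖gradientPart Complex.reCLM u s‖
      have := sq_nonneg ‖gradientPart Complex.imCLM u s‖
      nlinarith
    · have h1 : a s ^ 2 ≤ max 1 (a₁ ^ 2) := le_trans (by
        have := (ha' s hs).1
        gcongr
        exact (ha s hs).2) (le_max_right _ _)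
      have h2 := le_max_left 1 (a₁ ^ 2)
      have := sq_nonneg ‖velocityPart Complex.reCLM u s‖
      have := sq_nonneg ‖velocityPart Complex.imCLM u s‖
      have := sq_nonneg ‖gradientPart Complex.reCLM u s‖
      have := sq_nonneg ‖gradientPart Complex.imCLM u s‖
      nlinarith
  obtain ⟨e, he, hel, heu, hed⟩ := key t ht
  obtain ⟨e', he', hel', heu', hed'⟩ := key 0 le_rfl
  have h1 : e ≤ K * e' := by rw [hed, hed']; linarith [hre.1, him.1]
  have h2 : e' ≤ K * e := by rw [hed, hed']; linarith [hre.2, him.2]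
  have fin : ∀ {x y E E' : ℝ}, x ≤ K * y → min 1 (a₀ ^ 2) * y ≤ E' →
      E ≤ max 1 (a₁ ^ 2) * x → E ≤ max 1 (a₁ ^ 2) * K / min 1 (a₀ ^ 2) * E' := by
    intro x y E E' hxy hy hx
    calc E ≤ max 1 (a₁ ^ 2) * x := hx
      _ ≤ max 1 (a₁ ^ 2) * (K * y) := by gcongr
      _ = max 1 (a₁ ^ 2) * K / min 1 (a₀ ^ 2) * (min 1 (a₀ ^ 2) * y) := by field_simp
      _ ≤ _ := by gcongr
  exact ⟨fin h1 hel' heu, fin h2 hel heu'⟩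

end SemiDiscreteWave

open SemiDiscreteWave in
theorem theorem3p1 (d : ℕ) (a : ℝ → ℝ) (a₀ a₁ : ℝ) (ha₀ : 0 < a₀)
    (ha_meas : AEMeasurable a (volume.restrict (Ici 0)))
    (ha : ∀ t, 0 ≤ t → a₀ ≤ a t ∧ a t ≤ a₁) :
    (∀ Θ : ℝ → ℝ, PosMono Θ → Stabilizes a Θ → BddAbove (Θ '' Ici 0) → GEC d a) ∧
    (∀ Ξ : ℝ → ℝ, PosMono Ξ → DerivBounds 1 a Ξ →
      IntegrableOn (fun t => (Ξ t)⁻¹) (Ici 0) → GEC d a) ∧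
    (∀ (m : ℕ) (Θ Ξ : ℝ → ℝ), PosMono Θ → PosMono Ξ → Stabilizes a Θ → DerivBounds m a Ξ →
      Dominated Θ Ξ → TailBound m Θ Ξ → GEC d a) :=
  ⟨fun _ _ hst hb => gec_of_modeBound ha₀ ha
      (exists_modeBound_of_stabilizes_of_bddAbove ha_meas ha₀ ha hst hb),
    fun _ hΞ hd hint => gec_of_modeBound ha₀ ha
      (exists_modeBound_of_derivBounds_one ha₀ ha hΞ hd hint),
    fun _ _ _ hΘ hΞ hst hd hdom ht => gec_of_modeBound ha₀ ha
      (exists_modeBound_of_tailBound ha_meas ha₀ ha hΘ hΞ hst hd hdom ht)⟩
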